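/- Let $n\ge 3$, $\mu\in\mathbb R^n$, $\sigma>0$, and let $Y_i=\mu_i+\sigma\varepsilon_i$, $i=1,\dots,n$, where $\varepsilon_1,\dots,\varepsilon_n$ are i.i.d. standard Gaussian random variables. Let $\{\mathcal S_m,\ m\in\mathcal M\}$ be a finite collection of linear subspaces of $\mathbb R^n$, all contained in a linear subspace $\mathcal S_*\subset\mathbb R^n$ of dimension $d_*<n$; put $N_*=n-d_*$. Let $\{\pi_m,\ m\in\mathcal M\}$ be a probability distribution on $\mathcal M$, let $\{L_m,\ m\in\mathcal M\}$ be non-negative numbers and $\beta>0$. Write $\Pi_{\mathcal S}$ for the orthogonal projector onto $\mathcal S$ and $\|\cdot\|$ for the Euclidean norm, and set $$\hat\mu_m=\Pi_{\mathcal S_m}Y,\qquad \hat\sigma^2=\frac{\|Y-\Pi_{\mathcal S_*}Y\|^2}{N_*},\qquad \hat\mu=\sum_{m\in\mathcal M}w_m\hat\mu_m,\qquad w_m=\frac{\pi_m}{\mathcal Z}\exp\left(\beta\frac{\|\hat\mu_m\|^2}{\hat\sigma^2}-L_m\right),$$ where $\mathcal Z$ normalizes the sum of the $w_m$ to one. Let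 $\phi(x)=(x-1-\log x)/2$ for $x\in(0,1)$. Assume that $$\beta<\tfrac14,\qquad N_*\ge 2+\frac{\log n}{\phi(4\beta)},\qquad L_m\ge \tfrac12\dim(\mathcal S_m)\ \text{ for all } m\in\mathcal M.$$ Then $\|\mu-\hat\mu\|^2$ is integrable and $$\begin{aligned}\mathbb E\left[\|\mu-\hat\mu\|^2\right]&\le -(1+\varepsilon_n)\frac{\bar\sigma^2}{\beta}\log\left[\sum_{m\in\mathcal M}\pi_m\exp\left(-\frac{\beta\left[\|\mu-\Pi_{\mathcal S_m}\mu\|^2-\dim(\mathcal S_m)\sigma^2\right]}{\bar\sigma^2}-L_m\right)\right]+\frac{\sigma^2}{2\log n}\\&\le(1+\varepsilon_n)\inf_{m\in\mathcal M}\left\{\|\mu-\Pi_{\mathcal S_m}\mu\|^2+\frac{\bar\sigma^2}{\beta}\left(L_m-\log\pi_m\right)\right\}+\frac{\sigma^2}{2\log n},\end{aligned}$$ where $\varepsilon_n=(2n\log n)^{-1}$, $\bar\sigma^2=\sigma^2+\|\mu-\Pi_{\mathcal S_*}\mu\|^2/N_*$, and $-\log 0=+\infty$ (so models with $\pi_m=0$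 do not contribute to the infimum). -/

import Mathlib

open MeasureTheory ProbabilityTheory

namespace GibbsMixing

/-- `ℝⁿ` with the Euclidean norm. -/
abbrev Vec (n : ℕ) : Type := EuclideanSpace ℝ (Fin n)

/-- The function `φ(x) = (x - 1 - log x) / 2`, used on `(0, 1)`. -/
noncomputable def phi (x : ℝ) : ℝ := (x - 1 - Real.log x) / 2

/-- The observation `Y = μ + σ e` with noise vector `e`. -/
noncomputable def observation {n : ℕ} (μ : Vec n) (σ : ℝ) (e : Fin n → ℝ) : Vec n :=
  WithLp.toLp 2 (fun i => μ i + σ * e i)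

/-- The residual dimension `N_* = n - dim S_*`, as a real number. -/
noncomputable def residualDim {n : ℕ} (Sstar : Submodule ℝ (Vec n)) : ℝ :=
  (n : ℝ) - (Module.finrank ℝ Sstar : ℝ)

/-- The least-squares estimator on the model `S`: the orthogonal projection of `y` onto `S`. -/
noncomputable def leastSquares {n : ℕ} (S : Submodule ℝ (Vec n)) (y : Vec n) : Vec n :=
  S.starProjection y

/-- The residual variance estimator `‖y - Π_{S_*} y‖² / N_*`. -/
noncomputable def varianceEstimator {n : ℕ} (Sstar : Submodule ℝ (Vec n)) (y : Vec n) : ℝ :=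
  ‖y - Sstar.starProjection y‖ ^ 2 / residualDim Sstar

section Estimator

variable {n : ℕ} {M : Type*} [Fintype M]

/-- The weight of the model `m` before normalization:
`π_m exp (β ‖μ̂_m‖² / σ̂² - L_m)`. -/
noncomputable def rawWeight (S : M → Submodule ℝ (Vec n)) (Sstar : Submodule ℝ (Vec n))
    (π L : M → ℝ) (β : ℝ) (y : Vec n) (m : M) : ℝ :=
  π m * Real.exp (β * ‖leastSquares (S m) y‖ ^ 2 / varianceEstimator Sstar y - L m)

/-- The normalized weight `w_m`. -/
noncomputable def weight (S : M → Submodule ℝ (Vec n)) (Sstar : Submodule ℝ (Vec n))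
    (π L : M → ℝ) (β : ℝ) (y : Vec n) (m : M) : ℝ :=
  rawWeight S Sstar π L β y m / ∑ k, rawWeight S Sstar π L β y k

/-- The mixed estimator `μ̂ = ∑ w_m μ̂_m`. -/
noncomputable def mixedEstimator (S : M → Submodule ℝ (Vec n)) (Sstar : Submodule ℝ (Vec n))
    (π L : M → ℝ) (β : ℝ) (y : Vec n) : Vec n :=
  ∑ m, weight S Sstar π L β y m • leastSquares (S m) y

/-- `σ̄² = σ² + ‖μ - Π_{S_*} μ‖² / N_*`. -/
noncomputable def sigmaBarSq (Sstar : Submodule ℝ (Vec n)) (μ : Vec n) (σ : ℝ) : ℝ :=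
  σ ^ 2 + ‖μ - Sstar.starProjection μ‖ ^ 2 / residualDim Sstar

/-- `ε_n = (2 n log n)⁻¹`. -/
noncomputable def epsilonN (n : ℕ) : ℝ := (2 * (n : ℝ) * Real.log n)⁻¹

/-- The Gibbs-type risk bound. -/
noncomputable def gibbsBound (S : M → Submodule ℝ (Vec n)) (Sstar : Submodule ℝ (Vec n))
    (π L : M → ℝ) (β : ℝ) (μ : Vec n) (σ : ℝ) : ℝ :=
  -(1 + epsilonN n) * (sigmaBarSq Sstar μ σ / β) *
      Real.log (∑ m, π m * Real.exp
        (-β * (‖μ - (S m).starProjection μ‖ ^ 2 - (Module.finrank ℝ (S m) : ℝ) * σ ^ 2)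
            / sigmaBarSq Sstar μ σ - L m))
    + σ ^ 2 / (2 * Real.log n)

/-- The oracle risk bound. Models with `π_m = 0` have `-log π_m = +∞` and so do not contribute to
the infimum, which is therefore taken over the models with `π_m > 0`. -/
noncomputable def oracleBound (S : M → Submodule ℝ (Vec n)) (Sstar : Submodule ℝ (Vec n))
    (π L : M → ℝ) (β : ℝ) (μ : Vec n) (σ : ℝ) : ℝ :=
  (1 + epsilonN n) *
      (⨅ m : {m : M // 0 < π m}, (‖μ - (S m).starProjection μ‖ ^ 2
        + sigmaBarSq Sstar μ σ / β * (L m - Real.log (π m))))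
    + σ ^ 2 / (2 * Real.log n)

end Estimator

end GibbsMixing

/-
Freeze the component of `Y` orthogonal to `S_*`. Then `σ̂²` is a constant `s`, and the estimator is
the Gibbs mixture of projections at inverse temperature `β / s`. Its divergence contains the
posterior variance of the projections, which is also the gap between the posterior mean of the
residual sums of squares and the residual sum of squares of the mixture; so, up to the factor
`κ(s) = max(1, 4 β σ² / s)`, Stein's unbiased risk estimate is at most the free energy
`-log ∑ π_m exp (-energy)`. The free energy is concave in the energies, hence Jensen's inequality
bounds the conditional risk by the free energy at the mean energies.

It remains to average over `s`, of mean `σ̄²`. The function `s ↦ s * freeEnergy (a / s + L)` is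
concave and nondecreasing; where `κ(s) > 1` we have `s < σ̄²`, so replacing `s` by `σ̄²` along a
tangent line costs only `E[κ(s)] - 1`. This is at most `ε_n` by a Chernoff bound, since
`‖ν + u‖²` is stochastically smallest at `ν = 0` for `u` standard Gaussian.
-/

namespace GibbsMixing

lemma integrable_inner_of_memLp_two {α E : Type*} [MeasurableSpace α] {μ : Measure α}
    [NormedAddCommGroup E] [InnerProductSpace ℝ E] {f g : α → E} (hf : MemLp f 2 μ)
    (hg : MemLp g 2 μ) : Integrable (fun x => inner ℝ (f x) (g x)) μ :=
  (hf.norm.integrable_mul hg.norm).mono (hf.1.inner hg.1) <| .of_forall fun x => by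
    simpa using norm_inner_le_norm (𝕜 := ℝ) (f x) (g x)

section StdGaussian

variable {E : Type*} [NormedAddCommGroup E] [InnerProductSpace ℝ E]

/-- The density of the standard Gaussian measure on `E` with respect to Lebesgue measure. -/
noncomputable def gaussianDensity (E : Type*) [NormedAddCommGroup E] [InnerProductSpace ℝ E]
    (x : E) : ℝ :=
  (2 * Real.pi) ^ (-(Module.finrank ℝ E / 2 : ℝ)) * Real.exp (-(1 / 2) * ‖x‖ ^ 2)

lemma gaussianDensity_nonneg (x : E) : 0 ≤ gaussianDensity E x := by
  unfold gaussianDensity; positivity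

lemma continuous_gaussianDensity : Continuous (gaussianDensity E) := by
  unfold gaussianDensity; fun_prop

lemma hasFDerivAt_gaussianDensity (x : E) :
    HasFDerivAt (gaussianDensity E) (-(gaussianDensity E x) • innerSL ℝ x) x := by
  have h := (((hasFDerivAt_id x).norm_sq.const_mul (-(1 / 2) : ℝ)).exp).const_mul
    ((2 * Real.pi) ^ (-(Module.finrank ℝ E / 2 : ℝ)))
  refine h.congr_fderiv ?_
  ext v
  simp only [gaussianDensity, id_eq, ContinuousLinearMap.comp_id, neg_smul, neg_apply, smul_apply,
    coe_innerSL_apply, nsmul_eq_mul, Nat.cast_ofNat, smul_eq_mul]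
  ring

/-- The divergence of a vector field on `E`, as the trace of its derivative; it is junk where the
field is not differentiable. -/
noncomputable def divergence (h : E → E) (x : E) : ℝ :=
  LinearMap.trace ℝ E (fderiv ℝ h x)

lemma divergence_eq_sum_inner {ι : Type*} [Fintype ι] (b : OrthonormalBasis ι ℝ E) (h : E → E)
    (x : E) : divergence h x = ∑ i, inner ℝ (b i) (fderiv ℝ h x (b i)) :=
  LinearMap.trace_eq_sum_inner _ b

variable [FiniteDimensional ℝ E]

lemma trace_starProjection (T : Submodule ℝ E) :
    LinearMap.trace ℝ E T.starProjection.toLinearMap = Module.finrank ℝ T :=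
  LinearMap.IsProj.trace (p := T)
    ⟨T.starProjection_apply_mem, fun _ hx => Submodule.starProjection_eq_self_iff.2 hx⟩

lemma integrable_divergence_comp {Ω : Type*} [MeasurableSpace Ω] {P : Measure Ω} {h : E → E}
    {f : Ω → E} (hh : Integrable (fun ω => fderiv ℝ h (f ω)) P) :
    Integrable (fun ω => divergence h (f ω)) P :=
  (LinearMap.toContinuousLinearMap
    (LinearMap.trace ℝ E ∘ₗ ContinuousLinearMap.coeLM ℝ)).integrable_comp hh

variable [MeasurableSpace E] [BorelSpace E]

lemma integrable_gaussianDensity : Integrable (gaussianDensity E) := by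
  have h := (GaussianFourier.integrable_cexp_neg_mul_sq_norm_add (b := (1 / 2 : ℝ)) (V := E)
    (by norm_num) 0 0).norm
  refine Integrable.const_mul (h.congr (Filter.Eventually.of_forall fun x => ?_)) _
  simp only [Complex.norm_exp]
  congr 1
  norm_cast
  simp

lemma stdGaussian_eq_withDensity :
    stdGaussian E = volume.withDensity (fun x => ENNReal.ofReal (gaussianDensity E x)) := by
  have hfin : IsFiniteMeasure
      ((volume : Measure E).withDensity (fun x => ENNReal.ofReal (gaussianDensity E x))) :=
    isFiniteMeasure_withDensity_ofReal integrable_gaussianDensity.2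
  have hconst : ((Real.pi : ℂ) / (1 / 2)) ^ (Module.finrank ℝ E / 2 : ℂ)
      = (((2 * Real.pi) ^ (Module.finrank ℝ E / 2 : ℝ) : ℝ) : ℂ) := by
    rw [Complex.ofReal_cpow (by positivity)]
    push_cast
    ring_nf
  apply Measure.ext_of_charFun
  ext t
  have integrand_eq : ∀ x : E, (ENNReal.ofReal (gaussianDensity E x)).toReal •
      Complex.exp (inner ℝ x t * Complex.I)
      = (((2 * Real.pi) ^ (-(Module.finrank ℝ E / 2 : ℝ)) : ℝ) : ℂ) *
        Complex.exp (-(1 / 2) * ‖x‖ ^ 2 + Complex.I * inner ℝ t x) := by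
    intro x
    rw [ENNReal.toReal_ofReal (gaussianDensity_nonneg x), gaussianDensity, Complex.exp_add,
      Complex.real_smul, real_inner_comm]
    push_cast
    rw [mul_comm Complex.I]
    ring
  rw [charFun_stdGaussian, charFun_apply,
    integral_withDensity_eq_integral_toReal_smul
      (continuous_gaussianDensity.measurable.ennreal_ofReal)
      (Filter.Eventually.of_forall fun _ => ENNReal.ofReal_lt_top)]
  simp_rw [integrand_eq]
  rw [integral_const_mul, GaussianFourier.integral_cexp_neg_mul_sq_norm_add (by norm_num), hconst,
    ← mul_assoc, ← Complex.ofReal_mul, ← Real.rpow_add (by positivity)]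
  simp only [neg_add_cancel, Real.rpow_zero, Complex.ofReal_one, one_mul, Complex.I_sq]
  ring_nf

lemma integral_stdGaussian_eq {F : Type*} [NormedAddCommGroup F] [NormedSpace ℝ F] (f : E → F) :
    ∫ x, f x ∂(stdGaussian E) = ∫ x, gaussianDensity E x • f x := by
  rw [stdGaussian_eq_withDensity, integral_withDensity_eq_integral_toReal_smul
      (continuous_gaussianDensity.measurable.ennreal_ofReal)
      (Filter.Eventually.of_forall fun _ => ENNReal.ofReal_lt_top)]
  simp_rw [ENNReal.toReal_ofReal (gaussianDensity_nonneg _)]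

lemma integrable_stdGaussian_iff {f : E → ℝ} :
    Integrable f (stdGaussian E) ↔ Integrable (fun x => gaussianDensity E x * f x) := by
  rw [stdGaussian_eq_withDensity, integrable_withDensity_iff_integrable_smul'
      (continuous_gaussianDensity.measurable.ennreal_ofReal)
      (Filter.Eventually.of_forall fun _ => ENNReal.ofReal_lt_top)]
  simp_rw [ENNReal.toReal_ofReal (gaussianDensity_nonneg _), smul_eq_mul]

lemma integral_inner_mul_stdGaussian_eq_integral_fderiv {f : E → ℝ} (hf : Differentiable ℝ f)
    (v : E) (hf_int : Integrable f (stdGaussian E))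
    (hvf_int : Integrable (fun x => inner ℝ x v * f x) (stdGaussian E))
    (hf'_int : Integrable (fun x => fderiv ℝ f x v) (stdGaussian E)) :
    ∫ x, inner ℝ x v * f x ∂(stdGaussian E) = ∫ x, fderiv ℝ f x v ∂(stdGaussian E) := by
  have fderiv_density : ∀ x : E,
      fderiv ℝ (gaussianDensity E) x v = -(gaussianDensity E x * inner ℝ x v) := fun x => by
    simp [(hasFDerivAt_gaussianDensity x).fderiv]
  have by_parts := integral_mul_fderiv_eq_neg_fderiv_mul_of_integrable (μ := (volume : Measure E))
    (f := gaussianDensity E) (g := f) (v := v)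
    ((integrable_stdGaussian_iff.1 hvf_int).neg.congr <| .of_forall fun x => by
      simp only [fderiv_density, neg_mul, mul_assoc, Pi.neg_apply])
    (integrable_stdGaussian_iff.1 hf'_int) (integrable_stdGaussian_iff.1 hf_int)
    (fun x _ => (hasFDerivAt_gaussianDensity x).differentiableAt) (fun x _ => hf x)
  simp only [integral_stdGaussian_eq, smul_eq_mul, by_parts, fderiv_density, neg_mul,
    integral_neg, neg_neg, mul_assoc]

lemma memLp_two_id_stdGaussian : MemLp (fun x : E => x) 2 (stdGaussian E) :=
  IsGaussian.memLp_id _ 2 (by simp)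

lemma memLp_two_add_smul_stdGaussian (θ : E) (σ : ℝ) :
    MemLp (fun x => θ + σ • x) 2 (stdGaussian E) :=
  (memLp_const θ).add (memLp_two_id_stdGaussian.const_smul σ)

lemma integral_inner_stdGaussian (u : E) : ∫ x, inner ℝ u x ∂(stdGaussian E) = 0 :=
  integral_strongDual_stdGaussian (innerSL ℝ u)

theorem integral_inner_stdGaussian_eq_integral_divergence {h : E → E}
    (hh : Differentiable ℝ h) (hh_mem : MemLp h 2 (stdGaussian E))
    (hh'_int : Integrable (fderiv ℝ h) (stdGaussian E)) :
    ∫ x, inner ℝ x (h x) ∂(stdGaussian E) = ∫ x, divergence h x ∂(stdGaussian E) := by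
  let b := stdOrthonormalBasis ℝ E
  have fderiv_coord (i) (x : E) : fderiv ℝ (fun x => inner ℝ (b i) (h x)) x (b i)
      = inner ℝ (b i) (fderiv ℝ h x (b i)) := by
    have h_coord : HasFDerivAt (fun x => inner ℝ (b i) (h x)) _ x :=
      (innerSL ℝ (b i)).hasFDerivAt.comp x (hh x).hasFDerivAt
    rw [h_coord.fderiv]
    rfl
  have int_mul (i) : Integrable (fun x => inner ℝ x (b i) * inner ℝ (b i) (h x)) (stdGaussian E) :=
    (memLp_two_id_stdGaussian.inner_const (b i)).integrable_mul (hh_mem.const_inner (b i))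
  have int_fderiv (i) : Integrable (fun x => inner ℝ (b i) (fderiv ℝ h x (b i))) (stdGaussian E) :=
    ((innerSL ℝ (b i)).comp (ContinuousLinearMap.apply ℝ E (b i))).integrable_comp hh'_int
  calc ∫ x, inner ℝ x (h x) ∂(stdGaussian E)
      = ∑ i, ∫ x, inner ℝ x (b i) * inner ℝ (b i) (h x) ∂(stdGaussian E) := by
        rw [← integral_finsetSum _ fun i _ => int_mul i]
        simp_rw [b.sum_inner_mul_inner]
    _ = ∑ i, ∫ x, inner ℝ (b i) (fderiv ℝ h x (b i)) ∂(stdGaussian E) := by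
        refine Finset.sum_congr rfl fun i _ => ?_
        simp_rw [← fderiv_coord]
        exact integral_inner_mul_stdGaussian_eq_integral_fderiv
          (fun x => (differentiableAt_const (b i)).inner ℝ (hh x)) (b i)
          ((hh_mem.integrable (by norm_num)).const_inner (b i)) (int_mul i)
          (by simpa only [fderiv_coord] using int_fderiv i)
    _ = ∫ x, divergence h x ∂(stdGaussian E) := by
        rw [← integral_finsetSum _ fun i _ => int_fderiv i]
        simp_rw [divergence_eq_sum_inner b]

theorem integral_norm_sq_add_apply_stdGaussian {F : Type*} [NormedAddCommGroup F]
    [InnerProductSpace ℝ F] [CompleteSpace F] (a : F) (A : E →L[ℝ] F) :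
    ∫ x, ‖a + A x‖ ^ 2 ∂(stdGaussian E)
      = ‖a‖ ^ 2 + LinearMap.trace ℝ E (A.adjoint ∘L A).toLinearMap := by
  let B := A.adjoint ∘L A
  have hB : MemLp (fun x => B x) 2 (stdGaussian E) := B.comp_memLp' memLp_two_id_stdGaussian
  have norm_sq_eq (x : E) :
      ‖a + A x‖ ^ 2 = ‖a‖ ^ 2 + 2 * inner ℝ (A.adjoint a) x + inner ℝ x (B x) := by
    rw [norm_add_sq_real, A.adjoint_inner_left, ContinuousLinearMap.comp_apply,
      A.adjoint_inner_right, real_inner_self_eq_norm_sq]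
  have trace_eq : ∫ x, inner ℝ x (B x) ∂(stdGaussian E) = LinearMap.trace ℝ E B.toLinearMap := by
    rw [integral_inner_stdGaussian_eq_integral_divergence B.differentiable hB
      ((integrable_const B).congr (.of_forall fun x => B.fderiv.symm))]
    simp [divergence]
  have linear_int : Integrable (fun x : E => 2 * inner ℝ (A.adjoint a) x) (stdGaussian E) :=
    ((memLp_two_id_stdGaussian.integrable (by norm_num)).const_inner _).const_mul 2
  simp_rw [norm_sq_eq]
  rw [integral_add ((integrable_const _).fun_add linear_int)
      (integrable_inner_of_memLp_two memLp_two_id_stdGaussian hB),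
    integral_add (integrable_const _) linear_int, integral_const_mul, integral_inner_stdGaussian,
    trace_eq]
  simp [B]

theorem integral_norm_sub_starProjection_sq_stdGaussian (T : Submodule ℝ E) (θ : E) (σ : ℝ) :
    ∫ x, ‖(θ + σ • x) - T.starProjection (θ + σ • x)‖ ^ 2 ∂(stdGaussian E)
      = ‖θ - T.starProjection θ‖ ^ 2
        + ((Module.finrank ℝ E : ℝ) - Module.finrank ℝ T) * σ ^ 2 := by
  let A : E →L[ℝ] E := σ • Tᗮ.starProjection
  have adjoint_comp : A.adjoint ∘L A = σ ^ 2 • Tᗮ.starProjection := by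
    have adjoint_eq : A.adjoint = A := by
      simp [A, (isSelfAdjoint_starProjection Tᗮ).adjoint_eq]
    have comp_self : Tᗮ.starProjection ∘L Tᗮ.starProjection = Tᗮ.starProjection :=
      Tᗮ.isIdempotentElem_starProjection
    rw [adjoint_eq, ContinuousLinearMap.smul_comp, ContinuousLinearMap.comp_smul, comp_self,
      smul_smul, sq]
  have residual_eq (x : E) : (θ + σ • x) - T.starProjection (θ + σ • x)
      = Tᗮ.starProjection θ + A x := by
    rw [← Submodule.starProjection_orthogonal_val, map_add, map_smul]
    rfl
  have finrank_eq : (Module.finrank ℝ E : ℝ) = Module.finrank ℝ T + Module.finrank ℝ Tᗮ := by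
    exact_mod_cast T.finrank_add_finrank_orthogonal.symm
  simp_rw [residual_eq]
  rw [integral_norm_sq_add_apply_stdGaussian, adjoint_comp,
    ContinuousLinearMap.toLinearMap_smul, map_smul, trace_starProjection, finrank_eq,
    Submodule.starProjection_orthogonal_val, smul_eq_mul]
  ring

lemma integral_norm_sq_add_smul_stdGaussian (θ : E) (σ : ℝ) :
    ∫ x, ‖θ + σ • x‖ ^ 2 ∂(stdGaussian E) = ‖θ‖ ^ 2 + Module.finrank ℝ E * σ ^ 2 := by
  simpa using integral_norm_sub_starProjection_sq_stdGaussian ⊥ θ σ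

lemma integral_inner_comp_add_smul_stdGaussian {g : E → E} (θ : E) (σ : ℝ)
    (hg : Differentiable ℝ g) (hg_mem : MemLp (fun x => g (θ + σ • x)) 2 (stdGaussian E))
    (hg'_int : Integrable (fun x => fderiv ℝ g (θ + σ • x)) (stdGaussian E)) :
    ∫ x, inner ℝ x (g (θ + σ • x)) ∂(stdGaussian E)
      = σ * ∫ x, divergence g (θ + σ • x) ∂(stdGaussian E) := by
  have hasFDerivAt_comp (x : E) :
      HasFDerivAt (fun x => g (θ + σ • x)) (σ • fderiv ℝ g (θ + σ • x)) x := by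
    have h := (hg (θ + σ • x)).hasFDerivAt.comp x
      (((hasFDerivAt_id x).const_smul σ).const_add θ)
    rwa [ContinuousLinearMap.comp_smul, ContinuousLinearMap.comp_id] at h
  have fderiv_comp : fderiv ℝ (fun x => g (θ + σ • x)) = fun x => σ • fderiv ℝ g (θ + σ • x) :=
    funext fun x => (hasFDerivAt_comp x).fderiv
  rw [integral_inner_stdGaussian_eq_integral_divergence
    (fun x => (hasFDerivAt_comp x).differentiableAt) hg_mem
    (fderiv_comp ▸ hg'_int.smul σ), ← integral_const_mul]
  simp [divergence, fderiv_comp]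

theorem integral_norm_sub_sq_eq_stein {g : E → E} (θ : E) (σ : ℝ)
    (hg : Differentiable ℝ g) (hg_mem : MemLp (fun x => g (θ + σ • x)) 2 (stdGaussian E))
    (hg'_int : Integrable (fun x => fderiv ℝ g (θ + σ • x)) (stdGaussian E)) :
    ∫ x, ‖θ - g (θ + σ • x)‖ ^ 2 ∂(stdGaussian E)
      = ∫ x, ‖(θ + σ • x) - g (θ + σ • x)‖ ^ 2 ∂(stdGaussian E)
        + 2 * σ ^ 2 * ∫ x, divergence g (θ + σ • x) ∂(stdGaussian E)
        - Module.finrank ℝ E * σ ^ 2 := by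
  have expand (x : E) : ‖θ - g (θ + σ • x)‖ ^ 2
      = ‖(θ + σ • x) - g (θ + σ • x)‖ ^ 2 + 2 * σ * inner ℝ x (g (θ + σ • x))
        - (2 * σ * inner ℝ θ x + σ ^ 2 * ‖x‖ ^ 2) := by
    have h : θ - g (θ + σ • x) = ((θ + σ • x) - g (θ + σ • x)) - σ • x := by abel
    rw [h, norm_sub_sq_real, inner_smul_right, norm_smul, mul_pow, Real.norm_eq_abs, sq_abs,
      inner_sub_left, inner_add_left, real_inner_smul_left, real_inner_self_eq_norm_sq,
      real_inner_comm x (g _)]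
    ring
  have residual_int : Integrable (fun x => ‖(θ + σ • x) - g (θ + σ • x)‖ ^ 2) (stdGaussian E) :=
    ((memLp_two_add_smul_stdGaussian θ σ).sub hg_mem).integrable_norm_pow (by norm_num)
  have inner_int : Integrable (fun x => 2 * σ * inner ℝ x (g (θ + σ • x))) (stdGaussian E) :=
    (integrable_inner_of_memLp_two memLp_two_id_stdGaussian hg_mem).const_mul _
  have linear_int : Integrable (fun x : E => 2 * σ * inner ℝ θ x) (stdGaussian E) :=
    ((memLp_two_id_stdGaussian.integrable (by norm_num)).const_inner θ).const_mul _
  have norm_sq_int : Integrable (fun x : E => σ ^ 2 * ‖x‖ ^ 2) (stdGaussian E) :=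
    (memLp_two_id_stdGaussian.integrable_norm_pow (by norm_num)).const_mul _
  have norm_sq_eq : ∫ x : E, ‖x‖ ^ 2 ∂(stdGaussian E) = Module.finrank ℝ E := by
    simpa using integral_norm_sq_add_smul_stdGaussian (0 : E) 1
  simp_rw [expand]
  rw [integral_sub (residual_int.fun_add inner_int) (linear_int.fun_add norm_sq_int),
    integral_add residual_int inner_int, integral_add linear_int norm_sq_int,
    integral_const_mul, integral_const_mul, integral_const_mul, integral_inner_stdGaussian,
    integral_inner_comp_add_smul_stdGaussian θ σ hg hg_mem hg'_int, norm_sq_eq]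
  ring

lemma integral_exp_neg_mul_norm_add_sq_stdGaussian (ν : E) {l : ℝ} (hl : 0 < 1 + 2 * l) :
    ∫ x, Real.exp (-l * ‖ν + x‖ ^ 2) ∂(stdGaussian E)
      = Real.exp (-(l / (1 + 2 * l)) * ‖ν‖ ^ 2)
        * (1 + 2 * l) ^ (-(Module.finrank ℝ E / 2 : ℝ)) := by
  have complete_square (x : E) : gaussianDensity E x • Real.exp (-l * ‖ν + x‖ ^ 2)
      = ((2 * Real.pi) ^ (-(Module.finrank ℝ E / 2 : ℝ))
          * Real.exp (-(l / (1 + 2 * l)) * ‖ν‖ ^ 2))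
        * Real.exp (-((1 + 2 * l) / 2) * ‖x + (2 * l / (1 + 2 * l)) • ν‖ ^ 2) := by
    rw [gaussianDensity, smul_eq_mul, mul_assoc, mul_assoc, ← Real.exp_add, ← Real.exp_add]
    congr 2
    rw [norm_add_sq_real, norm_add_sq_real, inner_smul_right, norm_smul, mul_pow,
      Real.norm_eq_abs, sq_abs, real_inner_comm]
    field_simp
    ring
  have variance_eq : Real.pi / ((1 + 2 * l) / 2) = 2 * Real.pi * (1 + 2 * l)⁻¹ := by field_simp
  have normalization : (2 * Real.pi) ^ (-(Module.finrank ℝ E / 2 : ℝ))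
      * (2 * Real.pi) ^ (Module.finrank ℝ E / 2 : ℝ) = 1 := by
    rw [← Real.rpow_add (by positivity), neg_add_cancel, Real.rpow_zero]
  simp_rw [integral_stdGaussian_eq, complete_square]
  rw [integral_const_mul, integral_add_right_eq_self (μ := (volume : Measure E))
      (fun x => Real.exp (-((1 + 2 * l) / 2) * ‖x‖ ^ 2)),
    GaussianFourier.integral_rexp_neg_mul_sq_norm (by positivity), variance_eq,
    Real.mul_rpow (x := 2 * Real.pi) (by positivity) (by positivity), Real.inv_rpow hl.le,
    ← Real.rpow_neg hl.le]
  linear_combination Real.exp (-(l / (1 + 2 * l)) * ‖ν‖ ^ 2)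
    * (1 + 2 * l) ^ (-(Module.finrank ℝ E / 2 : ℝ)) * normalization

lemma stdGaussian_eq_map_prod (K : Submodule ℝ E) :
    stdGaussian E = ((stdGaussian K).prod (stdGaussian Kᗮ)).map
      (fun p => (p.1 : E) + (p.2 : E)) := by
  have hm : Measurable (fun p : K × Kᗮ => (p.1 : E) + (p.2 : E)) := by fun_prop
  have : IsProbabilityMeasure (((stdGaussian K).prod (stdGaussian Kᗮ)).map
      (fun p => (p.1 : E) + (p.2 : E))) := Measure.isProbabilityMeasure_map hm.aemeasurable
  apply Measure.ext_of_charFun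
  ext t
  rw [charFun_stdGaussian, charFun_apply, integral_map hm.aemeasurable (by fun_prop)]
  have exp_split : ∀ p : K × Kᗮ, Complex.exp (inner ℝ ((p.1 : E) + (p.2 : E)) t * Complex.I)
      = Complex.exp (inner ℝ p.1 (K.orthogonalProjectionOnto t) * Complex.I)
        * Complex.exp (inner ℝ p.2 (Kᗮ.orthogonalProjectionOnto t) * Complex.I) := by
    intro p
    rw [← Complex.exp_add, inner_add_left,
      Submodule.inner_orthogonalProjectionOnto_eq_of_mem_left,
      Submodule.inner_orthogonalProjectionOnto_eq_of_mem_left]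
    push_cast
    ring_nf
  simp_rw [exp_split]
  rw [integral_prod_mul (μ := stdGaussian K) (ν := stdGaussian Kᗮ)
    (fun x => Complex.exp (inner ℝ x (K.orthogonalProjectionOnto t) * Complex.I))
    (fun y => Complex.exp (inner ℝ y (Kᗮ.orthogonalProjectionOnto t) * Complex.I)),
    ← charFun_apply, ← charFun_apply, charFun_stdGaussian, charFun_stdGaussian, ← Complex.exp_add]
  have pythagoras := congrArg (fun r : ℝ => (r : ℂ)) (K.norm_sq_eq_add_norm_sq_projection t)
  push_cast at pythagoras
  rw [pythagoras]
  ring_nf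

end StdGaussian

section ChiSquare

open Real (exp log)

lemma phi_pos {x : ℝ} (h0 : 0 < x) (h1 : x < 1) : 0 < phi x := by
  have := Real.log_lt_sub_one_of_pos h0 h1.ne
  unfold phi; linarith

lemma two_lt_of_log_le_sub_two_mul_phi {a d : ℝ} {n : ℕ} (h0 : 0 < a) (h1 : a < 1) (hn : 1 < n)
    (hd : log n ≤ (d - 2) * phi a) : 2 < d := by
  have log_pos : 0 < log n := Real.log_pos (by exact_mod_cast hn)
  exact sub_pos.1 ((pos_iff_pos_of_mul_pos (log_pos.trans_le hd)).2 (phi_pos h0 h1))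

lemma four_mul_mul_phi_le {a : ℝ} (h0 : 0 < a) (h1 : a ≤ 1) : 4 * a * phi a ≤ (1 - a) ^ 2 := by
  have sinh_bound := Real.self_le_sinh_iff.2 (neg_nonneg.2 (Real.log_nonpos h0.le h1))
  rw [Real.sinh_eq, neg_neg, Real.exp_neg, Real.exp_log h0] at sinh_bound
  have neg_log_bound : a * -log a ≤ (1 - a ^ 2) / 2 :=
    (mul_le_mul_of_nonneg_left sinh_bound h0.le).trans_eq (by field_simp)
  unfold phi
  linear_combination 2 * neg_log_bound

lemma lintegral_Ioi_one_add_two_mul_rpow {l p : ℝ} (hl : 0 ≤ l) (hp : 1 < p) :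
    ∫⁻ t in Set.Ioi l, ENNReal.ofReal ((1 + 2 * t) ^ (-p))
      = ENNReal.ofReal ((1 + 2 * l) ^ (1 - p) / (2 * (p - 1))) := by
  have deriv (t : ℝ) (ht : t ∈ Set.Ici l) :
      HasDerivAt (fun t : ℝ => -(1 + 2 * t) ^ (1 - p) / (2 * (p - 1))) ((1 + 2 * t) ^ (-p)) t := by
    have pos : 0 < 1 + 2 * t := by linarith [Set.mem_Ici.1 ht]
    have h := ((((hasDerivAt_id t).const_mul 2).const_add 1).rpow_const (p := 1 - p)
      (Or.inl pos.ne')).neg.div_const (2 * (p - 1))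
    refine h.congr_deriv ?_
    have : p - 1 ≠ 0 := by linarith
    rw [show 1 - p - 1 = -p by ring]
    simp only [id]
    field_simp
    ring
  have nonneg (t : ℝ) (ht : t ∈ Set.Ioi l) : 0 ≤ (1 + 2 * t) ^ (-p) := by
    have := hl.trans_lt ht
    positivity
  have tends : Filter.Tendsto (fun t : ℝ => -(1 + 2 * t) ^ (1 - p) / (2 * (p - 1)))
      Filter.atTop (nhds 0) := by
    have h := (tendsto_rpow_neg_atTop (show 0 < p - 1 by linarith)).comp
      (Filter.tendsto_atTop_add_const_left _ 1
        (Filter.tendsto_id.const_mul_atTop (show (0 : ℝ) < 2 by norm_num)))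
    simpa using h.neg.div_const (2 * (p - 1))
  rw [← ofReal_integral_eq_lintegral_ofReal
      (integrableOn_Ioi_deriv_of_nonneg' deriv nonneg tends)
      ((ae_restrict_mem measurableSet_Ioi).mono nonneg),
    integral_Ioi_of_hasDerivAt_of_nonneg' deriv nonneg tends]
  ring_nf

lemma ofReal_exp_neg_mul_div_le_lintegral {X : ℝ} (hX : 0 ≤ X) (l : ℝ) :
    ENNReal.ofReal (exp (-l * X) / X) ≤ ∫⁻ t in Set.Ioi l, ENNReal.ofReal (exp (-t * X)) := by
  rcases hX.eq_or_lt with rfl | hX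
  · simp
  have integral_eq := integral_exp_mul_Ioi (neg_neg_of_pos hX) l
  have int := integrableOn_exp_mul_Ioi (neg_neg_of_pos hX) l
  rw [neg_div_neg_eq] at integral_eq
  simp_rw [neg_mul_comm, mul_comm _ (-X)]
  rw [← integral_eq, ofReal_integral_eq_lintegral_ofReal int
    (.of_forall fun t => Real.exp_nonneg _)]

/-- By `y ≤ exp (y - 1)` at `y = l (c - X)`. -/
lemma max_div_sub_one_le_exp_mul {c l X : ℝ} (hl : 0 < l) (hX : 0 ≤ X) :
    max (c / X - 1) 0 ≤ exp (l * c - 1) / l * (exp (-l * X) / X) := by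
  refine max_le ?_ (by positivity)
  rcases hX.eq_or_lt with rfl | hX
  · simp
  have tangent : l * (c - X) ≤ exp (l * c - 1) * exp (-l * X) := by
    rw [← Real.exp_add]
    linarith [Real.add_one_le_exp (l * c - 1 + -l * X)]
  rw [div_mul_div_comm, le_div_iff₀ (by positivity)]
  exact (by field_simp : (c / X - 1) * (l * X) = l * (c - X)).trans_le tangent

variable {E : Type*} [NormedAddCommGroup E] [InnerProductSpace ℝ E] [FiniteDimensional ℝ E]
  [MeasurableSpace E] [BorelSpace E]

lemma lintegral_exp_neg_mul_norm_add_sq_le (ν : E) {l : ℝ} (hl : 0 ≤ l) :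
    ∫⁻ x, ENNReal.ofReal (exp (-l * ‖ν + x‖ ^ 2)) ∂(stdGaussian E)
      ≤ ENNReal.ofReal ((1 + 2 * l) ^ (-(Module.finrank ℝ E / 2 : ℝ))) := by
  have exp_le_one (r x : ℝ) (hr : 0 ≤ r) : exp (-r * x ^ 2) ≤ 1 :=
    Real.exp_le_one_iff.2 (mul_nonpos_of_nonpos_of_nonneg (neg_nonpos.2 hr) (sq_nonneg x))
  have int : Integrable (fun x => exp (-l * ‖ν + x‖ ^ 2)) (stdGaussian E) :=
    Integrable.of_bound (Continuous.aestronglyMeasurable (by fun_prop)) 1 <| .of_forall fun x => by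
      rw [Real.norm_of_nonneg (Real.exp_nonneg _)]
      exact exp_le_one _ _ hl
  rw [← ofReal_integral_eq_lintegral_ofReal int (.of_forall fun x => Real.exp_nonneg _),
    integral_exp_neg_mul_norm_add_sq_stdGaussian ν (by positivity)]
  exact ENNReal.ofReal_le_ofReal
    (mul_le_of_le_one_left (by positivity) (exp_le_one _ _ (by positivity)))

lemma lintegral_exp_neg_mul_div_norm_add_sq_le (ν : E) {l : ℝ} (hl : 0 ≤ l)
    (hE : 2 < Module.finrank ℝ E) :
    ∫⁻ x, ENNReal.ofReal (exp (-l * ‖ν + x‖ ^ 2) / ‖ν + x‖ ^ 2) ∂(stdGaussian E)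
      ≤ ENNReal.ofReal ((1 + 2 * l) ^ (1 - (Module.finrank ℝ E / 2 : ℝ))
        / (Module.finrank ℝ E - 2)) := by
  have one_lt : (1 : ℝ) < Module.finrank ℝ E / 2 := by
    rw [lt_div_iff₀ two_pos]; exact_mod_cast hE
  calc ∫⁻ x, ENNReal.ofReal (exp (-l * ‖ν + x‖ ^ 2) / ‖ν + x‖ ^ 2) ∂(stdGaussian E)
      ≤ ∫⁻ x, (∫⁻ t in Set.Ioi l, ENNReal.ofReal (exp (-t * ‖ν + x‖ ^ 2))) ∂(stdGaussian E) :=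
        lintegral_mono fun x => ofReal_exp_neg_mul_div_le_lintegral (sq_nonneg _) l
    _ = ∫⁻ t in Set.Ioi l, ∫⁻ x, ENNReal.ofReal (exp (-t * ‖ν + x‖ ^ 2)) ∂(stdGaussian E) :=
        lintegral_lintegral_swap (by fun_prop)
    _ ≤ ∫⁻ t in Set.Ioi l, ENNReal.ofReal ((1 + 2 * t) ^ (-(Module.finrank ℝ E / 2 : ℝ))) :=
        setLIntegral_mono' measurableSet_Ioi fun t ht =>
          lintegral_exp_neg_mul_norm_add_sq_le ν (hl.trans (Set.mem_Ioi.1 ht).le)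
    _ = _ := by
        rw [lintegral_Ioi_one_add_two_mul_rpow hl one_lt]
        ring_nf

lemma integrable_exp_neg_mul_div_norm_add_sq (ν : E) {l : ℝ} (hl : 0 ≤ l)
    (hE : 2 < Module.finrank ℝ E) :
    Integrable (fun x => exp (-l * ‖ν + x‖ ^ 2) / ‖ν + x‖ ^ 2) (stdGaussian E) :=
  (lintegral_ofReal_ne_top_iff_integrable (Measurable.aestronglyMeasurable (by fun_prop))
    (.of_forall fun x => by positivity)).1
    ((lintegral_exp_neg_mul_div_norm_add_sq_le ν hl hE).trans_lt ENNReal.ofReal_lt_top).ne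

lemma integral_exp_neg_mul_div_norm_add_sq_le (ν : E) {l : ℝ} (hl : 0 ≤ l)
    (hE : 2 < Module.finrank ℝ E) :
    ∫ x, exp (-l * ‖ν + x‖ ^ 2) / ‖ν + x‖ ^ 2 ∂(stdGaussian E)
      ≤ (1 + 2 * l) ^ (1 - (Module.finrank ℝ E / 2 : ℝ)) / (Module.finrank ℝ E - 2) := by
  have : (2 : ℝ) < Module.finrank ℝ E := by exact_mod_cast hE
  rw [integral_eq_lintegral_of_nonneg_ae (.of_forall fun x => by positivity)
    (Measurable.aestronglyMeasurable (by fun_prop))]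
  exact ENNReal.toReal_le_of_le_ofReal
    (div_nonneg (by positivity) (by linarith))
    (lintegral_exp_neg_mul_div_norm_add_sq_le ν hl hE)

lemma integrable_max_div_norm_add_sq_sub_one (ν : E) (c : ℝ) (hE : 2 < Module.finrank ℝ E) :
    Integrable (fun x => max (c / ‖ν + x‖ ^ 2 - 1) 0) (stdGaussian E) := by
  refine ((integrable_exp_neg_mul_div_norm_add_sq ν zero_le_one hE).const_mul
    (exp (1 * c - 1) / 1)).mono' (Measurable.aestronglyMeasurable (by fun_prop))
    (.of_forall fun x => ?_)
  rw [Real.norm_of_nonneg (le_max_right _ _)]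
  exact max_div_sub_one_le_exp_mul one_pos (sq_nonneg _)

/-- The choice `l = (1 - a) / (2 a)` minimizes `exp (l a d) (1 + 2 l) ^ (-d / 2)`. -/
lemma integral_max_mul_finrank_div_norm_add_sq_sub_one_le (ν : E) {a : ℝ} (h0 : 0 < a) (h1 : a < 1)
    (hE : 2 < Module.finrank ℝ E) :
    ∫ x, max (a * Module.finrank ℝ E / ‖ν + x‖ ^ 2 - 1) 0 ∂(stdGaussian E)
      ≤ 2 * a * exp (-a) / (1 - a) * exp (-((Module.finrank ℝ E - 2) * phi a))
        / (Module.finrank ℝ E - 2) := by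
  set d : ℝ := (Module.finrank ℝ E : ℝ)
  set l := (1 - a) / (2 * a) with hl
  have hl_pos : 0 < l := div_pos (by linarith) (by linarith)
  have one_add_eq : 1 + 2 * l = a⁻¹ := by rw [hl]; field_simp; ring
  calc ∫ x, max (a * d / ‖ν + x‖ ^ 2 - 1) 0 ∂(stdGaussian E)
      ≤ ∫ x, exp (l * (a * d) - 1) / l * (exp (-l * ‖ν + x‖ ^ 2) / ‖ν + x‖ ^ 2)
          ∂(stdGaussian E) :=
        integral_mono (integrable_max_div_norm_add_sq_sub_one ν _ hE)
          ((integrable_exp_neg_mul_div_norm_add_sq ν hl_pos.le hE).const_mul _)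
          fun x => max_div_sub_one_le_exp_mul hl_pos (sq_nonneg _)
    _ ≤ exp (l * (a * d) - 1) / l * ((1 + 2 * l) ^ (1 - d / 2) / (d - 2)) := by
        rw [integral_const_mul]
        gcongr
        exact integral_exp_neg_mul_div_norm_add_sq_le ν hl_pos.le hE
    _ = l⁻¹ * exp (l * (a * d) - 1 + log a⁻¹ * (1 - d / 2)) / (d - 2) := by
        rw [one_add_eq, Real.rpow_def_of_pos (inv_pos.2 h0), Real.exp_add]
        ring
    _ = l⁻¹ * exp (-a + -((d - 2) * phi a)) / (d - 2) := by
        congr 3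
        rw [Real.log_inv, hl, phi]
        field_simp
        ring
    _ = _ := by
        rw [hl, inv_div, Real.exp_add]
        ring

theorem integral_max_mul_finrank_div_norm_add_sq_sub_one_le_epsilonN (ν : E) {a : ℝ} (h0 : 0 < a)
    (h1 : a < 1) {n : ℕ} (hn : 1 < n) (hE : log n ≤ (Module.finrank ℝ E - 2) * phi a) :
    ∫ x, max (a * Module.finrank ℝ E / ‖ν + x‖ ^ 2 - 1) 0 ∂(stdGaussian E) ≤ epsilonN n := by
  have phi_a_pos := phi_pos h0 h1
  have log_pos : 0 < log n := Real.log_pos (by exact_mod_cast hn)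
  have sub_two_pos : 0 < (Module.finrank ℝ E : ℝ) - 2 :=
    sub_pos.2 (two_lt_of_log_le_sub_two_mul_phi h0 h1 hn hE)
  have one_sub_pos : 0 < 1 - a := by linarith
  have inv_le : ((Module.finrank ℝ E : ℝ) - 2)⁻¹ ≤ phi a / log n := by
    rw [inv_le_comm₀ sub_two_pos (by positivity), inv_div, div_le_iff₀ phi_a_pos]
    exact hE
  have exp_phi_le : exp (-((Module.finrank ℝ E - 2) * phi a)) ≤ (n : ℝ)⁻¹ := by
    rw [← Real.exp_log (show (0 : ℝ) < n by positivity), ← Real.exp_neg]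
    simpa using hE
  have exp_neg_le : exp (-a) ≤ 1 := by simpa using h0.le
  calc ∫ x, max (a * Module.finrank ℝ E / ‖ν + x‖ ^ 2 - 1) 0 ∂(stdGaussian E)
      ≤ 2 * a * exp (-a) / (1 - a) * exp (-((Module.finrank ℝ E - 2) * phi a))
          * ((Module.finrank ℝ E : ℝ) - 2)⁻¹ :=
        integral_max_mul_finrank_div_norm_add_sq_sub_one_le ν h0 h1
          (by exact_mod_cast sub_pos.1 sub_two_pos)
    _ ≤ 2 * a * 1 / (1 - a) * (n : ℝ)⁻¹ * (phi a / log n) := by gcongr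
    _ = (4 * a * phi a) / ((1 - a) * (2 * n * log n)) := by field_simp; ring
    _ ≤ (1 - a) ^ 2 / ((1 - a) * (2 * n * log n)) := by
        gcongr
        exact four_mul_mul_phi_le h0 h1.le
    _ = (1 - a) * epsilonN n := by rw [epsilonN]; field_simp
    _ ≤ epsilonN n := mul_le_of_le_one_left (by unfold epsilonN; positivity) (by linarith)

end ChiSquare

section FreeEnergy

variable {M : Type*} [Fintype M] {π : M → ℝ}

/-- The partition function of the energy `q` under the prior `π`, which normalizes the Gibbs
distribution. -/
noncomputable def partitionFunction (π q : M → ℝ) : ℝ := ∑ m, π m * Real.exp (-q m)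

/-- The Gibbs distribution of the energy `q` under the prior `π`: the weights of the mixture. -/
noncomputable def gibbs (π q : M → ℝ) (m : M) : ℝ :=
  π m * Real.exp (-q m) / partitionFunction π q

/-- The free energy of the energy `q` under the prior `π`: the quantity which bounds the risk. -/
noncomputable def freeEnergy (π q : M → ℝ) : ℝ := -Real.log (partitionFunction π q)

lemma exists_pos_of_mem_stdSimplex (hπ : π ∈ stdSimplex ℝ M) : ∃ m, 0 < π m := by
  by_contra! h
  linarith [hπ.2, Finset.sum_nonpos fun m (_ : m ∈ Finset.univ) => h m]

lemma partitionFunction_pos (hπ : π ∈ stdSimplex ℝ M) (q : M → ℝ) :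
    0 < partitionFunction π q := by
  obtain ⟨m, hm⟩ := exists_pos_of_mem_stdSimplex hπ
  exact Finset.sum_pos' (fun k _ => mul_nonneg (hπ.1 k) (Real.exp_nonneg _))
    ⟨m, Finset.mem_univ m, by positivity⟩

lemma gibbs_mem_stdSimplex (hπ : π ∈ stdSimplex ℝ M) (q : M → ℝ) :
    gibbs π q ∈ stdSimplex ℝ M := by
  have hZ := partitionFunction_pos hπ q
  refine ⟨fun m => div_nonneg (mul_nonneg (hπ.1 m) (Real.exp_nonneg _)) hZ.le, ?_⟩
  simp_rw [gibbs]
  rw [← Finset.sum_div]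
  exact div_self hZ.ne'

lemma gibbs_eq_mul_exp (hπ : π ∈ stdSimplex ℝ M) (q : M → ℝ) (m : M) :
    gibbs π q m = π m * Real.exp (freeEnergy π q - q m) := by
  rw [freeEnergy, sub_eq_add_neg, Real.exp_add, Real.exp_neg,
    Real.exp_log (partitionFunction_pos hπ q), gibbs]
  ring

lemma freeEnergy_add_const (hπ : π ∈ stdSimplex ℝ M) (q : M → ℝ) (c : ℝ) :
    freeEnergy π (fun m => q m + c) = freeEnergy π q + c := by
  have hZ : partitionFunction π (fun m => q m + c) = partitionFunction π q * Real.exp (-c) := by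
    simp_rw [partitionFunction, neg_add, Real.exp_add, ← mul_assoc]
    rw [Finset.sum_mul]
  rw [freeEnergy, hZ, Real.log_mul (partitionFunction_pos hπ q).ne' (Real.exp_ne_zero _),
    Real.log_exp, freeEnergy]
  ring

lemma gibbs_add_const (hπ : π ∈ stdSimplex ℝ M) (q : M → ℝ) (c : ℝ) :
    gibbs π (fun m => q m + c) = gibbs π q := by
  ext m
  rw [gibbs_eq_mul_exp hπ, gibbs_eq_mul_exp hπ, freeEnergy_add_const hπ, add_sub_add_right_eq_sub]

lemma freeEnergy_le_add_sum_gibbs_mul_sub (hπ : π ∈ stdSimplex ℝ M) (q r : M → ℝ) :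
    freeEnergy π q ≤ freeEnergy π r + ∑ m, gibbs π r m * (q m - r m) := by
  have hr := gibbs_mem_stdSimplex hπ r
  have hratio : ∑ m, gibbs π r m * Real.exp (-(q m - r m))
      = partitionFunction π q / partitionFunction π r := by
    rw [partitionFunction, Finset.sum_div]
    refine Finset.sum_congr rfl fun m _ => ?_
    rw [gibbs, div_mul_eq_mul_div, mul_assoc, ← Real.exp_add]
    congr 3
    ring
  have hjensen := convexOn_exp.map_sum_le (t := Finset.univ) (w := gibbs π r)
    (p := fun m => -(q m - r m)) (fun m _ => hr.1 m) hr.2 (fun m _ => Set.mem_univ _)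
  have hq_pos := partitionFunction_pos hπ q
  have hr_pos := partitionFunction_pos hπ r
  simp only [smul_eq_mul] at hjensen
  rw [hratio, ← Real.le_log_iff_exp_le (by positivity),
    Real.log_div hq_pos.ne' hr_pos.ne'] at hjensen
  simp only [mul_neg, Finset.sum_neg_distrib] at hjensen
  rw [freeEnergy, freeEnergy]
  linarith

lemma freeEnergy_zero (hπ : π ∈ stdSimplex ℝ M) : freeEnergy π 0 = 0 := by
  simp [freeEnergy, partitionFunction, hπ.2]

lemma sum_gibbs_mul_le_freeEnergy (hπ : π ∈ stdSimplex ℝ M) (q : M → ℝ) :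
    ∑ m, gibbs π q m * q m ≤ freeEnergy π q := by
  have h := freeEnergy_le_add_sum_gibbs_mul_sub hπ 0 q
  simp only [freeEnergy_zero hπ, Pi.zero_apply, zero_sub, mul_neg, Finset.sum_neg_distrib] at h
  linarith

lemma freeEnergy_nonneg (hπ : π ∈ stdSimplex ℝ M) {q : M → ℝ} (hq : 0 ≤ q) :
    0 ≤ freeEnergy π q :=
  (Finset.sum_nonneg fun m _ => mul_nonneg ((gibbs_mem_stdSimplex hπ q).1 m) (hq m)).trans
    (sum_gibbs_mul_le_freeEnergy hπ q)

lemma freeEnergy_le_sub_log (hπ : π ∈ stdSimplex ℝ M) (q : M → ℝ) {m : M} (hm : 0 < π m) :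
    freeEnergy π q ≤ q m - Real.log (π m) := by
  have hterm : π m * Real.exp (-q m) ≤ partitionFunction π q :=
    Finset.single_le_sum (f := fun k => π k * Real.exp (-q k))
      (fun k _ => mul_nonneg (hπ.1 k) (Real.exp_nonneg _)) (Finset.mem_univ m)
  have hlog := Real.log_le_log (by positivity) hterm
  rw [Real.log_mul hm.ne' (Real.exp_ne_zero _), Real.log_exp] at hlog
  rw [freeEnergy]
  linarith

lemma integral_le_freeEnergy_integral {Ω : Type*} [MeasurableSpace Ω] {P : Measure Ω}
    [IsProbabilityMeasure P] (hπ : π ∈ stdSimplex ℝ M) {f : Ω → ℝ} {q : Ω → M → ℝ}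
    (hf : Integrable f P) (hq : ∀ m, Integrable (fun x => q x m) P)
    (hfq : ∀ x, f x ≤ freeEnergy π (q x)) :
    ∫ x, f x ∂P ≤ freeEnergy π (fun m => ∫ x, q x m ∂P) := by
  set r : M → ℝ := fun m => ∫ x, q x m ∂P
  have hterm (m : M) : Integrable (fun x => gibbs π r m * (q x m - r m)) P :=
    ((hq m).sub (integrable_const _)).const_mul _
  have hsum : Integrable (fun x => ∑ m, gibbs π r m * (q x m - r m)) P :=
    integrable_finsetSum _ fun m _ => hterm m
  calc ∫ x, f x ∂P
      ≤ ∫ x, freeEnergy π r + ∑ m, gibbs π r m * (q x m - r m) ∂P :=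
        integral_mono hf ((integrable_const _).add hsum) fun x =>
          (hfq x).trans (freeEnergy_le_add_sum_gibbs_mul_sub hπ (q x) r)
    _ = freeEnergy π r := by
        have hzero (m : M) : ∫ x, gibbs π r m * (q x m - r m) ∂P = 0 := by
          rw [integral_const_mul, integral_sub (hq m) (integrable_const _)]
          simp [r]
        rw [integral_add (integrable_const _) hsum, integral_finsetSum _ fun m _ => hterm m]
        simp [hzero]

-- `s ↦ s * freeEnergy π (a / s + L)` is a perspective of a concave function, hence concave, and
-- `c` is its slope at `t`.
lemma exists_nonneg_mul_freeEnergy_le (hπ : π ∈ stdSimplex ℝ M) (a : M → ℝ) {L : M → ℝ}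
    (hL : 0 ≤ L) {t : ℝ} (ht : 0 < t) :
    ∃ c, 0 ≤ c ∧ ∀ s, 0 < s → s * freeEnergy π (fun m => a m / s + L m)
      ≤ t * freeEnergy π (fun m => a m / t + L m) + c * (s - t) := by
  set q : ℝ → M → ℝ := fun s m => a m / s + L m
  set A : ℝ := ∑ m, gibbs π (q t) m * a m
  refine ⟨freeEnergy π (q t) - A / t, ?_, fun s hs => ?_⟩
  · have hsum : ∑ m, gibbs π (q t) m * q t m = A / t + ∑ m, gibbs π (q t) m * L m := by
      simp only [q, A, mul_add, Finset.sum_add_distrib, Finset.sum_div, mul_div_assoc]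
    have hL_mean : 0 ≤ ∑ m, gibbs π (q t) m * L m :=
      Finset.sum_nonneg fun m _ => mul_nonneg ((gibbs_mem_stdSimplex hπ _).1 m) (hL m)
    linarith [sum_gibbs_mul_le_freeEnergy hπ (q t)]
  · have hsum : ∑ m, gibbs π (q t) m * (q s m - q t m) = A * (1 / s - 1 / t) := by
      rw [Finset.sum_mul]
      exact Finset.sum_congr rfl fun m _ => by ring
    calc s * freeEnergy π (q s)
        ≤ s * (freeEnergy π (q t) + A * (1 / s - 1 / t)) := by
          rw [← hsum]
          exact mul_le_mul_of_nonneg_left (freeEnergy_le_add_sum_gibbs_mul_sub hπ _ _) hs.le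
      _ = t * freeEnergy π (q t) + (freeEnergy π (q t) - A / t) * (s - t) := by
          field_simp
          ring

variable {E : Type*} [NormedAddCommGroup E] [NormedSpace ℝ E] {q : E → M → ℝ}
  {q' : M → E →L[ℝ] ℝ} {y : E}

lemma hasFDerivAt_freeEnergy (hπ : π ∈ stdSimplex ℝ M)
    (hq : ∀ m, HasFDerivAt (fun y => q y m) (q' m) y) :
    HasFDerivAt (fun y => freeEnergy π (q y)) (∑ m, gibbs π (q y) m • q' m) y := by
  have hZ : HasFDerivAt (fun y => partitionFunction π (q y))
      (∑ m, π m • Real.exp (-q y m) • -q' m) y :=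
    HasFDerivAt.fun_sum fun m _ => ((hq m).neg.exp).const_mul (π m)
  refine (hZ.log (partitionFunction_pos hπ _).ne').neg.congr_fderiv ?_
  rw [← smul_neg, ← Finset.sum_neg_distrib, Finset.smul_sum]
  refine Finset.sum_congr rfl fun m _ => ?_
  simp only [smul_neg, neg_neg, smul_smul, gibbs]
  congr 1
  ring

lemma hasFDerivAt_gibbs (hπ : π ∈ stdSimplex ℝ M)
    (hq : ∀ m, HasFDerivAt (fun y => q y m) (q' m) y) (m : M) :
    HasFDerivAt (fun y => gibbs π (q y) m)
      (gibbs π (q y) m • (∑ k, gibbs π (q y) k • q' k - q' m)) y := by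
  simp_rw [gibbs_eq_mul_exp hπ _ m, mul_smul]
  exact (((hasFDerivAt_freeEnergy hπ hq).sub (hq m)).exp).const_mul (π m)

end FreeEnergy

section WeightedMean

variable {M E : Type*} [Fintype M] [NormedAddCommGroup E] [InnerProductSpace ℝ E]

lemma sum_mul_inner_sub_mean_eq_zero {w : M → ℝ} (hw : ∑ m, w m = 1) (p : M → E) (z : E) :
    ∑ m, w m * inner ℝ (p m - ∑ k, w k • p k) z = 0 := by
  simp_rw [← real_inner_smul_left]
  rw [← sum_inner]
  simp_rw [smul_sub]
  rw [Finset.sum_sub_distrib, ← Finset.sum_smul, hw, one_smul, sub_self, inner_zero_left]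

lemma sum_mul_inner_sub_mean {w : M → ℝ} (hw : ∑ m, w m = 1) (p : M → E) :
    ∑ m, w m * inner ℝ (p m - ∑ k, w k • p k) (p m)
      = ∑ m, w m * ‖p m - ∑ k, w k • p k‖ ^ 2 := by
  have split (m : M) : w m * inner ℝ (p m - ∑ k, w k • p k) (p m)
      = w m * ‖p m - ∑ k, w k • p k‖ ^ 2
        + w m * inner ℝ (p m - ∑ k, w k • p k) (∑ k, w k • p k) := by
    rw [← real_inner_self_eq_norm_sq, ← mul_add, ← inner_add_right, sub_add_cancel]
  simp_rw [split]
  rw [Finset.sum_add_distrib, sum_mul_inner_sub_mean_eq_zero hw, add_zero]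

lemma sum_mul_norm_sub_sq {w : M → ℝ} (hw : ∑ m, w m = 1) (p : M → E) (y : E) :
    ∑ m, w m * ‖y - p m‖ ^ 2
      = ∑ m, w m * ‖p m - ∑ k, w k • p k‖ ^ 2 + ‖y - ∑ k, w k • p k‖ ^ 2 := by
  have split (m : M) : w m * ‖y - p m‖ ^ 2
      = w m * ‖p m - ∑ k, w k • p k‖ ^ 2
        - 2 * (w m * inner ℝ (p m - ∑ k, w k • p k) (y - ∑ k, w k • p k))
        + w m * ‖y - ∑ k, w k • p k‖ ^ 2 := by
    rw [← sub_sub_sub_cancel_right y (p m) (∑ k, w k • p k), norm_sub_sq_real, real_inner_comm]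
    ring
  simp_rw [split]
  rw [Finset.sum_add_distrib, Finset.sum_sub_distrib, ← Finset.mul_sum, ← Finset.sum_mul, hw,
    sum_mul_inner_sub_mean_eq_zero hw]
  ring

end WeightedMean

section GibbsMixture

variable {M E : Type*} [NormedAddCommGroup E] [InnerProductSpace ℝ E] [FiniteDimensional ℝ E]

/-- The energy of the models `T` at the observation `y`: the residual sums of squares at inverse
temperature `b`, penalized by `L`. The weights `exp (b ‖Π_m y‖² - L_m)` of the estimator differ
from `exp (-energy)` by a factor common to all models. -/
noncomputable def energy (T : M → Submodule ℝ E) (L : M → ℝ) (b : ℝ) (y : E) (m : M) : ℝ :=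
  b * ‖y - (T m).starProjection y‖ ^ 2 + L m

lemma norm_sub_starProjection_sq (T : Submodule ℝ E) (y : E) :
    ‖y - T.starProjection y‖ ^ 2 = ‖y‖ ^ 2 - ‖T.starProjection y‖ ^ 2 := by
  rw [← Submodule.starProjection_orthogonal_val,
    Submodule.norm_sq_eq_add_norm_sq_starProjection y T, add_sub_cancel_left]

lemma hasFDerivAt_norm_sub_starProjection_sq (T : Submodule ℝ E) (y : E) :
    HasFDerivAt (fun y => ‖y - T.starProjection y‖ ^ 2)
      ((2 : ℝ) • innerSL ℝ (y - T.starProjection y)) y := by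
  simp_rw [← Submodule.starProjection_orthogonal_val]
  refine Tᗮ.starProjection.hasFDerivAt.norm_sq.congr_fderiv ?_
  ext v
  have self_proj : inner ℝ (Tᗮ.starProjection y) (Tᗮ.starProjection v)
      = inner ℝ (Tᗮ.starProjection y) v := by
    rw [← Submodule.inner_starProjection_left_eq_right, Submodule.starProjection_eq_self_iff.2
      (Submodule.starProjection_apply_mem Tᗮ y)]
  simp only [ContinuousLinearMap.comp_apply, smul_apply, innerSL_apply_apply, self_proj,
    nsmul_eq_mul, Nat.cast_ofNat, smul_eq_mul]

variable [Fintype M]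

/-- The Gibbs mixture of the projections of `y` on the models `T`, at the inverse temperature `b`:
the mixed estimator once the variance estimate is frozen. -/
noncomputable def gibbsMixture (T : M → Submodule ℝ E) (π L : M → ℝ) (b : ℝ) (y : E) : E :=
  ∑ m, gibbs π (energy T L b y) m • (T m).starProjection y

variable {T : M → Submodule ℝ E} {π L : M → ℝ} {b : ℝ}

lemma norm_sum_smul_starProjection_le {w : M → ℝ} (hw : w ∈ stdSimplex ℝ M)
    (T : M → Submodule ℝ E) (y : E) : ‖∑ m, w m • (T m).starProjection y‖ ≤ ‖y‖ :=
  mem_closedBall_zero_iff.1 <| (convex_closedBall (0 : E) ‖y‖).sum_mem (fun m _ => hw.1 m) hw.2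
    fun m _ => mem_closedBall_zero_iff.2 ((T m).norm_starProjection_apply_le y)

lemma norm_gibbsMixture_le (hπ : π ∈ stdSimplex ℝ M) (y : E) : ‖gibbsMixture T π L b y‖ ≤ ‖y‖ :=
  norm_sum_smul_starProjection_le (gibbs_mem_stdSimplex hπ _) T y

lemma norm_starProjection_sub_gibbsMixture_le (hπ : π ∈ stdSimplex ℝ M) (K : Submodule ℝ E)
    (y : E) : ‖K.starProjection y - gibbsMixture T π L b y‖ ≤ 2 * ‖y‖ :=
  (norm_sub_le _ _).trans <| by
    linarith [K.norm_starProjection_apply_le y,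
      norm_gibbsMixture_le hπ (T := T) (L := L) (b := b) y]

lemma hasFDerivAt_gibbs_energy (hπ : π ∈ stdSimplex ℝ M) (y : E) (m : M) :
    HasFDerivAt (fun y => gibbs π (energy T L b y) m)
      ((gibbs π (energy T L b y) m * (2 * b)) •
        innerSL ℝ ((T m).starProjection y - gibbsMixture T π L b y)) y := by
  refine (hasFDerivAt_gibbs hπ (fun k => ((hasFDerivAt_norm_sub_starProjection_sq (T k)
    y).const_mul b).add_const (L k)) m).congr_fderiv ?_
  have hw := (gibbs_mem_stdSimplex hπ (energy T L b y)).2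
  have mean_residual : ∑ k, gibbs π (energy T L b y) k • (y - (T k).starProjection y)
      = y - gibbsMixture T π L b y := by
    simp_rw [smul_sub]
    rw [Finset.sum_sub_distrib, ← Finset.sum_smul, hw, one_smul, gibbsMixture]
  change gibbs π (energy T L b y) m • (∑ k, gibbs π (energy T L b y) k •
    b • (2 : ℝ) • innerSL ℝ (y - (T k).starProjection y)
      - b • (2 : ℝ) • innerSL ℝ (y - (T m).starProjection y)) = _
  simp only [← map_smul, ← map_sum, ← map_sub]
  simp_rw [smul_comm (gibbs π (energy T L b y) _) b,
    smul_comm (gibbs π (energy T L b y) _) (2 : ℝ)]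
  rw [← Finset.smul_sum, ← Finset.smul_sum, mean_residual]
  congr 1
  module

lemma hasFDerivAt_gibbsMixture (hπ : π ∈ stdSimplex ℝ M) (y : E) :
    HasFDerivAt (gibbsMixture T π L b)
      (∑ m, (gibbs π (energy T L b y) m • (T m).starProjection
        + ((gibbs π (energy T L b y) m * (2 * b)) •
          innerSL ℝ ((T m).starProjection y - gibbsMixture T π L b y)).smulRight
            ((T m).starProjection y))) y :=
  HasFDerivAt.fun_sum fun m _ =>
    (hasFDerivAt_gibbs_energy hπ y m).smul (T m).starProjection.hasFDerivAt

lemma differentiable_gibbsMixture (hπ : π ∈ stdSimplex ℝ M) :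
    Differentiable ℝ (gibbsMixture T π L b) :=
  fun y => (hasFDerivAt_gibbsMixture hπ y).differentiableAt

lemma norm_fderiv_gibbsMixture_le (hπ : π ∈ stdSimplex ℝ M) (hb : 0 ≤ b) (y : E) :
    ‖fderiv ℝ (gibbsMixture T π L b) y‖ ≤ 1 + 4 * b * ‖y‖ ^ 2 := by
  have hw := gibbs_mem_stdSimplex hπ (energy T L b y)
  set w := gibbs π (energy T L b y)
  have term_le (m : M) : ‖w m • (T m).starProjection + ((w m * (2 * b)) •
      innerSL ℝ ((T m).starProjection y - gibbsMixture T π L b y)).smulRight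
        ((T m).starProjection y)‖ ≤ w m * (1 + 4 * b * ‖y‖ ^ 2) := by
    have hwm := hw.1 m
    refine (norm_add_le _ _).trans ?_
    rw [norm_smul, ContinuousLinearMap.norm_smulRight_apply, norm_smul, innerSL_apply_norm,
      Real.norm_of_nonneg hwm, Real.norm_of_nonneg (by positivity)]
    calc w m * ‖(T m).starProjection‖ + w m * (2 * b)
          * ‖(T m).starProjection y - gibbsMixture T π L b y‖ * ‖(T m).starProjection y‖
        ≤ w m * 1 + w m * (2 * b) * (2 * ‖y‖) * ‖y‖ := by
          gcongr
          · exact (T m).starProjection_norm_le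
          · exact norm_starProjection_sub_gibbsMixture_le hπ (T m) y
          · exact (T m).norm_starProjection_apply_le y
      _ = w m * (1 + 4 * b * ‖y‖ ^ 2) := by ring
  rw [(hasFDerivAt_gibbsMixture hπ y).fderiv]
  refine (norm_sum_le _ _).trans ((Finset.sum_le_sum fun m _ => term_le m).trans_eq ?_)
  rw [← Finset.sum_mul, hw.2, one_mul]

lemma divergence_gibbsMixture (hπ : π ∈ stdSimplex ℝ M) (y : E) :
    divergence (gibbsMixture T π L b) y
      = ∑ m, gibbs π (energy T L b y) m * Module.finrank ℝ (T m)
        + 2 * b * ∑ m, gibbs π (energy T L b y) m *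
          ‖(T m).starProjection y - gibbsMixture T π L b y‖ ^ 2 := by
  have variance := sum_mul_inner_sub_mean (gibbs_mem_stdSimplex hπ (energy T L b y)).2
    (fun m => (T m).starProjection y)
  rw [← gibbsMixture] at variance
  rw [← variance, divergence, (hasFDerivAt_gibbsMixture hπ y).fderiv,
    ContinuousLinearMap.toLinearMap_sum, map_sum, Finset.mul_sum, ← Finset.sum_add_distrib]
  refine Finset.sum_congr rfl fun m _ => ?_
  rw [ContinuousLinearMap.toLinearMap_add, map_add, ContinuousLinearMap.toLinearMap_smul, map_smul,
    trace_starProjection, smul_eq_mul]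
  congr 1
  refine (LinearMap.trace_smulRight _ _).trans ?_
  simp only [ContinuousLinearMap.coe_coe, smul_apply, innerSL_apply_apply, smul_eq_mul]
  ring

lemma mul_sum_gibbs_norm_sub_sq_add_le_freeEnergy (hπ : π ∈ stdSimplex ℝ M) (y : E) :
    b * ∑ m, gibbs π (energy T L b y) m * ‖y - (T m).starProjection y‖ ^ 2
        + ∑ m, gibbs π (energy T L b y) m * L m
      ≤ freeEnergy π (energy T L b y) := by
  refine le_of_eq_of_le ?_ (sum_gibbs_mul_le_freeEnergy hπ (energy T L b y))
  simp only [energy, mul_add, Finset.sum_add_distrib, Finset.mul_sum, mul_left_comm b]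

-- The spread of the projections around their mean enters Stein's estimate with the coefficient
-- `4 b σ² - 1`. It is at most the mean residual, whose excess `max 1 (4 b σ²) - 1` pays for it,
-- while the penalties `L` pay for the dimensions.
lemma norm_sub_gibbsMixture_sq_add_divergence_le (hπ : π ∈ stdSimplex ℝ M) (hb : 0 < b)
    (hL : ∀ m, (Module.finrank ℝ (T m) : ℝ) / 2 ≤ L m) (σ : ℝ) (y : E) :
    ‖y - gibbsMixture T π L b y‖ ^ 2 + 2 * σ ^ 2 * divergence (gibbsMixture T π L b) y
      ≤ max 1 (4 * b * σ ^ 2) / b * freeEnergy π (energy T L b y) := by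
  have hw := gibbs_mem_stdSimplex hπ (energy T L b y)
  have bias_variance := sum_mul_norm_sub_sq hw.2 (fun m => (T m).starProjection y) y
  have energy_le := mul_sum_gibbs_norm_sub_sq_add_le_freeEnergy hπ (T := T) (L := L) (b := b) y
  rw [← gibbsMixture] at bias_variance
  rw [divergence_gibbsMixture hπ]
  set w := gibbs π (energy T L b y)
  set κ := max 1 (4 * b * σ ^ 2)
  have one_le : 1 ≤ κ := le_max_left _ _
  have le_kappa : 4 * b * σ ^ 2 ≤ κ := le_max_right _ _
  have dim_le : 2 * σ ^ 2 * ∑ m, w m * Module.finrank ℝ (T m) ≤ κ / b * ∑ m, w m * L m := by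
    rw [Finset.mul_sum, Finset.mul_sum]
    refine Finset.sum_le_sum fun m _ => ?_
    have coeff_le : 4 * σ ^ 2 ≤ κ / b := by rw [le_div_iff₀ hb]; linarith
    calc 2 * σ ^ 2 * (w m * Module.finrank ℝ (T m))
        = w m * (4 * σ ^ 2 * (Module.finrank ℝ (T m) / 2)) := by ring
      _ ≤ w m * (κ / b * L m) := by
          have hwm := hw.1 m
          gcongr
          exact hL m
      _ = κ / b * (w m * L m) := by ring
  set V := ∑ m, w m * ‖(T m).starProjection y - gibbsMixture T π L b y‖ ^ 2
  set R := ∑ m, w m * ‖y - (T m).starProjection y‖ ^ 2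
  have V_nonneg : 0 ≤ V := Finset.sum_nonneg fun m _ => mul_nonneg (hw.1 m) (sq_nonneg _)
  have V_le_R : V ≤ R := bias_variance ▸ le_add_of_nonneg_right (sq_nonneg _)
  have spread_le : (4 * b * σ ^ 2 - 1) * V ≤ (κ - 1) * R :=
    (mul_le_mul_of_nonneg_right (by linarith) V_nonneg).trans
      (mul_le_mul_of_nonneg_left V_le_R (by linarith))
  calc ‖y - gibbsMixture T π L b y‖ ^ 2
        + 2 * σ ^ 2 * (∑ m, w m * Module.finrank ℝ (T m) + 2 * b * V)
      = R + (4 * b * σ ^ 2 - 1) * V + 2 * σ ^ 2 * ∑ m, w m * Module.finrank ℝ (T m) := by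
        rw [bias_variance]; ring
    _ ≤ R + (κ - 1) * R + κ / b * ∑ m, w m * L m := by gcongr
    _ = κ / b * (b * R + ∑ m, w m * L m) := by field_simp; ring
    _ ≤ κ / b * freeEnergy π (energy T L b y) := by gcongr

end GibbsMixture

section ConditionalRisk

variable {E : Type*} [NormedAddCommGroup E] [InnerProductSpace ℝ E] [FiniteDimensional ℝ E]

/-- The mean residual sum of squares of the model `T` at a Gaussian observation with mean `θ` and
variance `σ ^ 2`: the squared bias plus the variance of the residual. -/
noncomputable def meanResidualSq (T : Submodule ℝ E) (θ : E) (σ : ℝ) : ℝ :=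
  ‖θ - T.starProjection θ‖ ^ 2 + ((Module.finrank ℝ E : ℝ) - Module.finrank ℝ T) * σ ^ 2

lemma meanResidualSq_nonneg (T : Submodule ℝ E) (θ : E) (σ : ℝ) : 0 ≤ meanResidualSq T θ σ :=
  add_nonneg (sq_nonneg _)
    (mul_nonneg (sub_nonneg.2 (by exact_mod_cast T.finrank_le)) (sq_nonneg σ))

variable [MeasurableSpace E] [BorelSpace E] {M : Type*} [Fintype M] {T : M → Submodule ℝ E}
  {π L : M → ℝ} {b : ℝ}

lemma memLp_two_gibbsMixture (hπ : π ∈ stdSimplex ℝ M) (θ : E) (σ : ℝ) :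
    MemLp (fun x => gibbsMixture T π L b (θ + σ • x)) 2 (stdGaussian E) := by
  have hg := (differentiable_gibbsMixture hπ (T := T) (L := L) (b := b)).continuous
  exact (memLp_two_add_smul_stdGaussian θ σ).of_le
    (hg.comp (by fun_prop)).aestronglyMeasurable (.of_forall fun x => norm_gibbsMixture_le hπ _)

lemma integrable_fderiv_gibbsMixture (hπ : π ∈ stdSimplex ℝ M) (hb : 0 ≤ b) (θ : E) (σ : ℝ) :
    Integrable (fun x => fderiv ℝ (gibbsMixture T π L b) (θ + σ • x)) (stdGaussian E) := by
  have hbound : Integrable (fun x => 1 + 4 * b * ‖θ + σ • x‖ ^ 2) (stdGaussian E) :=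
    (integrable_const _).add ((memLp_two_add_smul_stdGaussian θ σ).integrable_norm_pow
      two_ne_zero |>.const_mul _)
  exact hbound.mono' ((measurable_fderiv ℝ _).comp (by fun_prop)).aestronglyMeasurable
    (.of_forall fun x => norm_fderiv_gibbsMixture_le hπ hb _)

lemma integrable_norm_sub_starProjection_sq (K : Submodule ℝ E) (θ : E) (σ : ℝ) :
    Integrable (fun x => ‖(θ + σ • x) - K.starProjection (θ + σ • x)‖ ^ 2) (stdGaussian E) := by
  simp_rw [← Submodule.starProjection_orthogonal_val]
  exact (Kᗮ.starProjection.comp_memLp' (memLp_two_add_smul_stdGaussian θ σ)).integrable_norm_pow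
    two_ne_zero

lemma integral_norm_sub_gibbsMixture_sq_le (hπ : π ∈ stdSimplex ℝ M) (hb : 0 < b)
    (hL : ∀ m, (Module.finrank ℝ (T m) : ℝ) / 2 ≤ L m) (θ : E) (σ : ℝ) :
    ∫ x, ‖θ - gibbsMixture T π L b (θ + σ • x)‖ ^ 2 ∂(stdGaussian E)
      ≤ max 1 (4 * b * σ ^ 2) / b
          * freeEnergy π (fun m => b * meanResidualSq (T m) θ σ + L m)
        - Module.finrank ℝ E * σ ^ 2 := by
  have hg := memLp_two_gibbsMixture hπ (T := T) (L := L) (b := b) θ σ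
  have hg' := integrable_fderiv_gibbsMixture hπ hb.le (T := T) (L := L) θ σ
  have residual_int : Integrable
      (fun x => ‖(θ + σ • x) - gibbsMixture T π L b (θ + σ • x)‖ ^ 2) (stdGaussian E) :=
    ((memLp_two_add_smul_stdGaussian θ σ).sub hg).integrable_norm_pow two_ne_zero
  have divergence_int : Integrable
      (fun x => 2 * σ ^ 2 * divergence (gibbsMixture T π L b) (θ + σ • x)) (stdGaussian E) :=
    (integrable_divergence_comp hg').const_mul _
  have energy_int (m : M) : Integrable (fun x => energy T L b (θ + σ • x) m) (stdGaussian E) :=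
    ((integrable_norm_sub_starProjection_sq (T m) θ σ).const_mul b).add (integrable_const _)
  have mean_energy (m : M) : ∫ x, energy T L b (θ + σ • x) m ∂(stdGaussian E)
      = b * meanResidualSq (T m) θ σ + L m := by
    simp_rw [energy, meanResidualSq]
    rw [integral_add ((integrable_norm_sub_starProjection_sq (T m) θ σ).const_mul b)
      (integrable_const _), integral_const_mul, integral_norm_sub_starProjection_sq_stdGaussian]
    simp
  set κ := max 1 (4 * b * σ ^ 2)
  have κ_pos : 0 < κ := one_pos.trans_le (le_max_left _ _)
  have sure_le := integral_le_freeEnergy_integral hπ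
    ((residual_int.add divergence_int).const_mul (b / κ)) energy_int fun x => by
      have h := norm_sub_gibbsMixture_sq_add_divergence_le hπ hb hL σ (θ + σ • x)
      rw [div_mul_eq_mul_div, le_div_iff₀ hb] at h
      rw [Pi.add_apply, div_mul_eq_mul_div, div_le_iff₀ κ_pos]
      linarith
  rw [integral_norm_sub_sq_eq_stein θ σ (differentiable_gibbsMixture hπ) hg hg',
    ← integral_const_mul, ← integral_add residual_int divergence_int]
  simp only [Pi.add_apply, mean_energy] at sure_le
  rw [integral_const_mul, div_mul_eq_mul_div, div_le_iff₀ κ_pos] at sure_le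
  gcongr
  rw [div_mul_eq_mul_div, le_div_iff₀ hb]
  linarith

end ConditionalRisk

section RandomTemperature

variable {M : Type*} [Fintype M] {π : M → ℝ}

-- Where the maximum exceeds `1` we have `s < v ≤ t`, so the slope term only helps.
lemma exists_max_mul_freeEnergy_le (hπ : π ∈ stdSimplex ℝ M) (a : M → ℝ) {L : M → ℝ}
    (hL : 0 ≤ L) {t v : ℝ} (ht : 0 < t) (hvt : v ≤ t) :
    ∃ c, ∀ s, 0 < s → max 1 (v / s) * (s * freeEnergy π (fun m => a m / s + L m))
      ≤ (1 + max (v / s - 1) 0) * (t * freeEnergy π (fun m => a m / t + L m)) + c * (s - t) := by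
  obtain ⟨c, c_nonneg, hc⟩ := exists_nonneg_mul_freeEnergy_le hπ a hL ht
  refine ⟨c, fun s hs => ?_⟩
  have max_eq : max 1 (v / s) = 1 + max (v / s - 1) 0 := by
    rw [← max_add_add_left, add_sub_cancel, add_zero, max_comm]
  set κ := max (v / s - 1) 0
  have slope_nonpos : κ * (c * (s - t)) ≤ 0 := by
    rcases le_total v s with hvs | hsv
    · rw [show κ = 0 from max_eq_right (sub_nonpos.2 ((div_le_one hs).2 hvs)), zero_mul]
    · exact mul_nonpos_of_nonneg_of_nonpos (le_max_right _ _)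
        (mul_nonpos_of_nonneg_of_nonpos c_nonneg (by linarith))
  have κ_nonneg : 0 ≤ κ := le_max_right _ _
  calc max 1 (v / s) * (s * freeEnergy π (fun m => a m / s + L m))
      ≤ (1 + κ) * (t * freeEnergy π (fun m => a m / t + L m) + c * (s - t)) := by
        rw [max_eq]
        exact mul_le_mul_of_nonneg_left (hc s hs) (add_nonneg zero_le_one κ_nonneg)
    _ ≤ (1 + κ) * (t * freeEnergy π (fun m => a m / t + L m)) + c * (s - t) := by linarith

lemma integral_le_of_le_max_mul_freeEnergy {Ω : Type*} [MeasurableSpace Ω] {P : Measure Ω}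
    [IsProbabilityMeasure P] (hπ : π ∈ stdSimplex ℝ M) {a L : M → ℝ} (hL : 0 ≤ L) {v : ℝ}
    {s f : Ω → ℝ} (hs_int : Integrable s P) (hs_pos : ∀ᵐ ω ∂P, 0 < s ω) (hv : v ≤ ∫ ω, s ω ∂P)
    (ht : 0 < ∫ ω, s ω ∂P) (hκ : Integrable (fun ω => max (v / s ω - 1) 0) P)
    (hf_int : Integrable f P) (hf : ∀ᵐ ω ∂P,
      f ω ≤ max 1 (v / s ω) * (s ω * freeEnergy π (fun m => a m / s ω + L m))) :
    ∫ ω, f ω ∂P ≤ (1 + ∫ ω, max (v / s ω - 1) 0 ∂P)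
      * ((∫ ω, s ω ∂P) * freeEnergy π (fun m => a m / (∫ ω, s ω ∂P) + L m)) := by
  set t := ∫ ω, s ω ∂P with ht_def
  set G := t * freeEnergy π (fun m => a m / t + L m)
  obtain ⟨c, hc⟩ := exists_max_mul_freeEnergy_le hπ a hL ht hv
  have κ_int : Integrable (fun ω => (1 + max (v / s ω - 1) 0) * G) P :=
    ((integrable_const _).add hκ).mul_const G
  have slope_int : Integrable (fun ω => c * (s ω - t)) P :=
    (hs_int.sub (integrable_const t)).const_mul c
  calc ∫ ω, f ω ∂P
      ≤ ∫ ω, (1 + max (v / s ω - 1) 0) * G + c * (s ω - t) ∂P :=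
        integral_mono_ae hf_int (κ_int.add slope_int) <| by
          filter_upwards [hs_pos, hf] with ω hsω hfω using hfω.trans (hc (s ω) hsω)
    _ = (1 + ∫ ω, max (v / s ω - 1) 0 ∂P) * G := by
        rw [integral_add κ_int slope_int, integral_mul_const, integral_const_mul,
          integral_add (integrable_const _) hκ, integral_sub hs_int (integrable_const _), ← ht_def]
        simp

variable {E : Type*} [NormedAddCommGroup E] [InnerProductSpace ℝ E]

lemma mul_sq_div_norm_add_smul_sq (ν u : E) (a : ℝ) {σ : ℝ} (hσ : σ ≠ 0) :
    a * σ ^ 2 / (‖ν + σ • u‖ ^ 2 / Module.finrank ℝ E)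
      = a * Module.finrank ℝ E / ‖σ⁻¹ • ν + u‖ ^ 2 := by
  have scale : ν + σ • u = σ • (σ⁻¹ • ν + u) := by rw [smul_add, smul_inv_smul₀ hσ]
  rw [scale, norm_smul, mul_pow, Real.norm_eq_abs, sq_abs]
  field_simp

variable [FiniteDimensional ℝ E] [MeasurableSpace E] [BorelSpace E]

lemma ae_norm_add_smul_sq_div_finrank_pos (ν : E) {σ : ℝ} (hσ : σ ≠ 0)
    (hE : 0 < Module.finrank ℝ E) :
    ∀ᵐ u ∂(stdGaussian E), 0 < ‖ν + σ • u‖ ^ 2 / Module.finrank ℝ E := by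
  have : Nontrivial E := Module.nontrivial_of_finrank_pos hE
  have null : stdGaussian E {-(σ⁻¹ • ν)} = 0 := by
    rw [stdGaussian_eq_withDensity]
    exact withDensity_absolutelyContinuous _ _ (measure_singleton _)
  filter_upwards [compl_mem_ae_iff.2 null] with u hu
  have ne_zero : ν + σ • u ≠ 0 := fun h => hu <| eq_neg_of_add_eq_zero_right <| by
    rw [← smul_eq_zero_iff_right hσ, smul_add, smul_inv_smul₀ hσ, h]
  have := norm_pos_iff.2 ne_zero
  positivity

lemma integral_norm_add_smul_sq_div_finrank (ν : E) (σ : ℝ) (hE : 0 < Module.finrank ℝ E) :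
    ∫ u, ‖ν + σ • u‖ ^ 2 / Module.finrank ℝ E ∂(stdGaussian E)
      = σ ^ 2 + ‖ν‖ ^ 2 / Module.finrank ℝ E := by
  rw [integral_div, integral_norm_sq_add_smul_stdGaussian]
  field_simp
  ring

section ExcessFactor

variable {σ : ℝ} (ν : E) (hσ : σ ≠ 0)
include hσ

lemma integrable_max_mul_sq_div_norm_add_smul_sq_sub_one (a : ℝ)
    (hE : 2 < Module.finrank ℝ E) :
    Integrable (fun u => max (a * σ ^ 2 / (‖ν + σ • u‖ ^ 2 / Module.finrank ℝ E) - 1) 0)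
      (stdGaussian E) := by
  simp_rw [mul_sq_div_norm_add_smul_sq ν _ a hσ]
  exact integrable_max_div_norm_add_sq_sub_one _ _ hE

lemma integral_max_mul_sq_div_norm_add_smul_sq_sub_one_le_epsilonN {a : ℝ} (h0 : 0 < a)
    (h1 : a < 1) {n : ℕ} (hn : 1 < n) (hE : Real.log n ≤ (Module.finrank ℝ E - 2) * phi a) :
    ∫ u, max (a * σ ^ 2 / (‖ν + σ • u‖ ^ 2 / Module.finrank ℝ E) - 1) 0 ∂(stdGaussian E)
      ≤ epsilonN n := by
  simp_rw [mul_sq_div_norm_add_smul_sq ν _ a hσ]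
  exact integral_max_mul_finrank_div_norm_add_sq_sub_one_le_epsilonN _ h0 h1 hn hE

end ExcessFactor

lemma mul_integral_norm_sub_gibbsMixture_div_sq_add_le {T : M → Submodule ℝ E} {L : M → ℝ}
    {β s : ℝ} (hπ : π ∈ stdSimplex ℝ M) (hβ : 0 < β) (hs : 0 < s)
    (hL : ∀ m, (Module.finrank ℝ (T m) : ℝ) / 2 ≤ L m) (θ : E) (σ : ℝ) :
    β * (∫ x, ‖θ - gibbsMixture T π L (β / s) (θ + σ • x)‖ ^ 2 ∂(stdGaussian E)
        + Module.finrank ℝ E * σ ^ 2)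
      ≤ max 1 (4 * β * σ ^ 2 / s)
        * (s * freeEnergy π (fun m => β * meanResidualSq (T m) θ σ / s + L m)) := by
  have h := integral_norm_sub_gibbsMixture_sq_le hπ (div_pos hβ hs) hL θ σ
  have factor_eq : 4 * (β / s) * σ ^ 2 = 4 * β * σ ^ 2 / s := by ring
  simp_rw [factor_eq, div_mul_eq_mul_div β s] at h
  refine (mul_le_mul_of_nonneg_left (le_sub_iff_add_le.1 h) hβ.le).trans_eq ?_
  field_simp

variable {F : Type*} [NormedAddCommGroup F] [InnerProductSpace ℝ F] [FiniteDimensional ℝ F]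
  [MeasurableSpace F] [BorelSpace F]

theorem integral_integral_norm_sub_gibbsMixture_sq_le {T : M → Submodule ℝ E} {L : M → ℝ}
    {β σ : ℝ} {n : ℕ} (hn : 1 < n) (θ : E) (ν : F) (hσ : 0 < σ) (hπ : π ∈ stdSimplex ℝ M)
    (hL : ∀ m, (Module.finrank ℝ (T m) : ℝ) / 2 ≤ L m) (hβ0 : 0 < β) (hβ : β < 1 / 4)
    (hN : Real.log n ≤ (Module.finrank ℝ F - 2) * phi (4 * β))
    (hint : Integrable (fun u => ∫ x, ‖θ - gibbsMixture T π L
      (β / (‖ν + σ • u‖ ^ 2 / Module.finrank ℝ F)) (θ + σ • x)‖ ^ 2 ∂(stdGaussian E))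
      (stdGaussian F)) :
    ∫ u, (∫ x, ‖θ - gibbsMixture T π L (β / (‖ν + σ • u‖ ^ 2 / Module.finrank ℝ F))
        (θ + σ • x)‖ ^ 2 ∂(stdGaussian E)) ∂(stdGaussian F)
      ≤ (1 + epsilonN n) * ((σ ^ 2 + ‖ν‖ ^ 2 / Module.finrank ℝ F) / β
          * freeEnergy π (fun m =>
            β * meanResidualSq (T m) θ σ / (σ ^ 2 + ‖ν‖ ^ 2 / Module.finrank ℝ F) + L m))
        - Module.finrank ℝ E * σ ^ 2 := by
  have two_lt := two_lt_of_log_le_sub_two_mul_phi (by linarith) (by linarith) hn hN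
  have finrank_pos : 0 < Module.finrank ℝ F := by
    exact_mod_cast (by linarith : (0 : ℝ) < Module.finrank ℝ F)
  have hL_nonneg : 0 ≤ L := fun m => (by positivity : (0 : ℝ) ≤ _).trans (hL m)
  have s_mean := integral_norm_add_smul_sq_div_finrank ν σ finrank_pos
  have s_pos := ae_norm_add_smul_sq_div_finrank_pos ν hσ.ne' finrank_pos
  set s : F → ℝ := fun u => ‖ν + σ • u‖ ^ 2 / Module.finrank ℝ F
  set t := σ ^ 2 + ‖ν‖ ^ 2 / Module.finrank ℝ F
  have s_int : Integrable s (stdGaussian F) :=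
    ((memLp_two_add_smul_stdGaussian ν σ).integrable_norm_pow two_ne_zero).div_const _
  have t_pos : 0 < t := by positivity
  have hσt : 4 * β * σ ^ 2 ≤ t := by
    have : 0 ≤ ‖ν‖ ^ 2 / Module.finrank ℝ F := by positivity
    nlinarith [sq_nonneg σ]
  have mean_le := integral_le_of_le_max_mul_freeEnergy hπ hL_nonneg s_int s_pos
    (s_mean ▸ hσt) (s_mean ▸ t_pos)
    (integrable_max_mul_sq_div_norm_add_smul_sq_sub_one ν hσ.ne' _ (by exact_mod_cast two_lt))
    ((hint.add (integrable_const (Module.finrank ℝ E * σ ^ 2))).const_mul β)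
    (s_pos.mono fun u hu => mul_integral_norm_sub_gibbsMixture_div_sq_add_le hπ hβ0 hu hL θ σ)
  rw [s_mean] at mean_le
  have excess_le := integral_max_mul_sq_div_norm_add_smul_sq_sub_one_le_epsilonN ν hσ.ne'
    (by linarith) (by linarith) hn hN
  have freeEnergy_nonneg := freeEnergy_nonneg hπ (q := fun m =>
    β * meanResidualSq (T m) θ σ / t + L m) fun m => add_nonneg
      (div_nonneg (mul_nonneg hβ0.le (meanResidualSq_nonneg _ θ σ)) t_pos.le) (hL_nonneg m)
  have scaled_le := mean_le.trans (mul_le_mul_of_nonneg_right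
    (add_le_add_right excess_le 1) (mul_nonneg t_pos.le freeEnergy_nonneg))
  simp only [Pi.add_apply] at scaled_le
  rw [integral_const_mul, integral_add hint (integrable_const _), integral_const, probReal_univ,
    one_smul, ← le_div_iff₀' hβ0] at scaled_le
  refine le_sub_iff_add_le.2 (scaled_le.trans_eq ?_)
  ring

end RandomTemperature

section OrthogonalDecomposition

variable {E : Type*} [NormedAddCommGroup E] [InnerProductSpace ℝ E] {S K : Submodule ℝ E}

lemma norm_coe_add_coe_orthogonal_sq (x : K) (u : Kᗮ) :
    ‖(x : E) + u‖ ^ 2 = ‖x‖ ^ 2 + ‖u‖ ^ 2 := by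
  simpa only [← sq, Submodule.coe_norm] using
    norm_add_sq_eq_norm_sq_add_norm_sq_real (Submodule.inner_right_of_mem_orthogonal x.2 u.2)

variable [FiniteDimensional ℝ E]

lemma starProjection_coe_add_coe_orthogonal (h : S ≤ K) (x : K) (u : Kᗮ) :
    S.starProjection ((x : E) + u) = ((S.comap K.subtype).starProjection x : K) := by
  rw [map_add, (Submodule.starProjection_apply_eq_zero_iff S).2 (Submodule.orthogonal_le h u.2),
    add_zero]
  refine Submodule.eq_starProjection_of_mem_of_inner_eq_zero ?_ fun z hz => ?_
  · exact Submodule.starProjection_apply_mem (S.comap K.subtype) x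
  · exact Submodule.starProjection_inner_eq_zero (K := S.comap K.subtype) x ⟨z, h hz⟩ hz

lemma norm_sub_starProjection_coe_add_coe_orthogonal_sq (h : S ≤ K) (x : K) (u : Kᗮ) :
    ‖((x : E) + u) - S.starProjection ((x : E) + u)‖ ^ 2
      = ‖x - (S.comap K.subtype).starProjection x‖ ^ 2 + ‖u‖ ^ 2 := by
  rw [starProjection_coe_add_coe_orthogonal h, add_sub_right_comm, ← Submodule.coe_sub,
    norm_coe_add_coe_orthogonal_sq]

lemma norm_sub_starProjection_coe_add_coe_orthogonal_self_sq (x : K) (u : Kᗮ) :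
    ‖((x : E) + u) - K.starProjection ((x : E) + u)‖ ^ 2 = ‖u‖ ^ 2 := by
  rw [map_add, Submodule.starProjection_eq_self_iff.2 x.2,
    (Submodule.starProjection_apply_eq_zero_iff K).2 u.2, add_zero, add_sub_cancel_left,
    Submodule.norm_coe]

lemma meanResidualSq_comap_subtype (h : S ≤ K) (θ : K) (ν : Kᗮ) (σ : ℝ) :
    meanResidualSq (S.comap K.subtype) θ σ
      = ‖((θ : E) + ν) - S.starProjection ((θ : E) + ν)‖ ^ 2 - Module.finrank ℝ S * σ ^ 2
        + (Module.finrank ℝ K * σ ^ 2 - ‖ν‖ ^ 2) := by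
  rw [meanResidualSq, norm_sub_starProjection_coe_add_coe_orthogonal_sq h,
    (Submodule.comapSubtypeEquivOfLe h).finrank_eq]
  ring

end OrthogonalDecomposition

section MixedEstimator

variable {n : ℕ} {M : Type*} [Fintype M] {S : M → Submodule ℝ (Vec n)}
  {Sstar : Submodule ℝ (Vec n)} {π L : M → ℝ} {β : ℝ}

lemma residualDim_eq_finrank_orthogonal (K : Submodule ℝ (Vec n)) :
    residualDim K = Module.finrank ℝ Kᗮ := by
  rw [residualDim, sub_eq_iff_eq_add']
  exact_mod_cast (K.finrank_add_finrank_orthogonal.trans finrank_euclideanSpace_fin).symm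

lemma varianceEstimator_coe_add_coe_orthogonal (x : Sstar) (u : Sstarᗮ) :
    varianceEstimator Sstar ((x : Vec n) + u) = ‖u‖ ^ 2 / Module.finrank ℝ Sstarᗮ := by
  rw [varianceEstimator, residualDim_eq_finrank_orthogonal,
    norm_sub_starProjection_coe_add_coe_orthogonal_self_sq]

lemma sigmaBarSq_coe_add_coe_orthogonal (θ : Sstar) (ν : Sstarᗮ) (σ : ℝ) :
    sigmaBarSq Sstar ((θ : Vec n) + ν) σ = σ ^ 2 + ‖ν‖ ^ 2 / Module.finrank ℝ Sstarᗮ := by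
  rw [sigmaBarSq, residualDim_eq_finrank_orthogonal,
    norm_sub_starProjection_coe_add_coe_orthogonal_self_sq]

lemma weight_eq_gibbs (y : Vec n) :
    weight S Sstar π L β y = gibbs π (fun m =>
      L m - β * ‖leastSquares (S m) y‖ ^ 2 / varianceEstimator Sstar y) := by
  ext m
  simp only [weight, rawWeight, gibbs, partitionFunction, neg_sub]

lemma mixedEstimator_coe_add_coe_orthogonal (hπ : π ∈ stdSimplex ℝ M) (hS : ∀ m, S m ≤ Sstar)
    (x : Sstar) (u : Sstarᗮ) :
    mixedEstimator S Sstar π L β ((x : Vec n) + u)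
      = (gibbsMixture (fun m => (S m).comap Sstar.subtype) π L
          (β / (‖u‖ ^ 2 / Module.finrank ℝ Sstarᗮ)) x : Sstar) := by
  set b := β / (‖u‖ ^ 2 / Module.finrank ℝ Sstarᗮ)
  have projection (m : M) : leastSquares (S m) ((x : Vec n) + u)
      = ((S m).comap Sstar.subtype).starProjection x :=
    starProjection_coe_add_coe_orthogonal (hS m) x u
  have energy_eq : energy (fun m => (S m).comap Sstar.subtype) L b x = fun m =>
      L m - β * ‖leastSquares (S m) ((x : Vec n) + u)‖ ^ 2
        / varianceEstimator Sstar ((x : Vec n) + u) + b * ‖x‖ ^ 2 := by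
    ext m
    rw [energy, norm_sub_starProjection_sq, projection, Submodule.norm_coe,
      varianceEstimator_coe_add_coe_orthogonal]
    ring
  simp only [mixedEstimator, gibbsMixture, weight_eq_gibbs, energy_eq, gibbs_add_const hπ,
    projection, Submodule.coe_sum, Submodule.coe_smul]

lemma norm_sub_mixedEstimator_sq_eq (hπ : π ∈ stdSimplex ℝ M) (hS : ∀ m, S m ≤ Sstar)
    (θ x : Sstar) (ν u : Sstarᗮ) (σ : ℝ) :
    ‖((θ : Vec n) + ν) - mixedEstimator S Sstar π L β
        (((θ : Vec n) + ν) + σ • ((x : Vec n) + u))‖ ^ 2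
      = ‖θ - gibbsMixture (fun m => (S m).comap Sstar.subtype) π L
          (β / (‖ν + σ • u‖ ^ 2 / Module.finrank ℝ Sstarᗮ)) (θ + σ • x)‖ ^ 2 + ‖ν‖ ^ 2 := by
  have regroup : ((θ : Vec n) + ν) + σ • ((x : Vec n) + u)
      = ((θ + σ • x : Sstar) : Vec n) + (ν + σ • u : Sstarᗮ) := by
    push_cast
    module
  rw [regroup, mixedEstimator_coe_add_coe_orthogonal hπ hS, add_sub_right_comm,
    ← Submodule.coe_sub, norm_coe_add_coe_orthogonal_sq]

lemma measurable_mixedEstimator : Measurable (mixedEstimator S Sstar π L β) := by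
  unfold mixedEstimator weight rawWeight varianceEstimator leastSquares
  fun_prop

lemma integrable_norm_sub_mixedEstimator_sq (hπ : π ∈ stdSimplex ℝ M) (μ : Vec n) (σ : ℝ) :
    Integrable (fun z => ‖μ - mixedEstimator S Sstar π L β (μ + σ • z)‖ ^ 2)
      (stdGaussian (Vec n)) := by
  have mixed_memLp : MemLp (fun z => mixedEstimator S Sstar π L β (μ + σ • z)) 2
      (stdGaussian (Vec n)) :=
    (memLp_two_add_smul_stdGaussian μ σ).of_le
      (measurable_mixedEstimator.comp (by fun_prop)).aestronglyMeasurable <| .of_forall fun z => by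
        rw [mixedEstimator, weight_eq_gibbs]
        exact norm_sum_smul_starProjection_le (gibbs_mem_stdSimplex hπ _) S _
  exact ((memLp_const μ).sub mixed_memLp).integrable_norm_pow two_ne_zero

lemma integrable_prod_norm_sub_gibbsMixture_sq (hπ : π ∈ stdSimplex ℝ M) (hS : ∀ m, S m ≤ Sstar)
    (θ : Sstar) (ν : Sstarᗮ) (σ : ℝ) :
    Integrable (fun p : Sstar × Sstarᗮ =>
      ‖θ - gibbsMixture (fun m => (S m).comap Sstar.subtype) π L
        (β / (‖ν + σ • p.2‖ ^ 2 / Module.finrank ℝ Sstarᗮ)) (θ + σ • p.1)‖ ^ 2)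
      ((stdGaussian Sstar).prod (stdGaussian Sstarᗮ)) := by
  have mixed_int := integrable_norm_sub_mixedEstimator_sq (S := S) (Sstar := Sstar) (L := L)
    (β := β) hπ ((θ : Vec n) + ν) σ
  rw [stdGaussian_eq_map_prod Sstar] at mixed_int
  refine ((mixed_int.comp_measurable (by fun_prop)).sub (integrable_const (‖ν‖ ^ 2))).congr
    (.of_forall fun p => ?_)
  simp only [Pi.sub_apply, Function.comp_apply, norm_sub_mixedEstimator_sq_eq hπ hS,
    add_sub_cancel_right]

lemma integral_norm_sub_mixedEstimator_sq_eq (hπ : π ∈ stdSimplex ℝ M) (hS : ∀ m, S m ≤ Sstar)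
    (θ : Sstar) (ν : Sstarᗮ) (σ : ℝ) :
    ∫ z, ‖((θ : Vec n) + ν) - mixedEstimator S Sstar π L β (((θ : Vec n) + ν) + σ • z)‖ ^ 2
        ∂(stdGaussian (Vec n))
      = ∫ u, (∫ x, ‖θ - gibbsMixture (fun m => (S m).comap Sstar.subtype) π L
          (β / (‖ν + σ • u‖ ^ 2 / Module.finrank ℝ Sstarᗮ)) (θ + σ • x)‖ ^ 2
          ∂(stdGaussian Sstar)) ∂(stdGaussian Sstarᗮ) + ‖ν‖ ^ 2 := by
  have mixed_int := integrable_norm_sub_mixedEstimator_sq (S := S) (Sstar := Sstar) (L := L)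
    (β := β) hπ ((θ : Vec n) + ν) σ
  have prod_int := integrable_prod_norm_sub_gibbsMixture_sq (L := L) (β := β) hπ hS θ ν σ
  rw [stdGaussian_eq_map_prod Sstar] at mixed_int ⊢
  rw [integral_map (Measurable.aemeasurable (by fun_prop)) mixed_int.1]
  simp only [norm_sub_mixedEstimator_sq_eq hπ hS]
  rw [integral_add prod_int (integrable_const _), integral_prod_symm _ prod_int]
  simp

end MixedEstimator

section RiskBounds

variable {n : ℕ} {M : Type*} [Fintype M] {S : M → Submodule ℝ (Vec n)}
  {Sstar : Submodule ℝ (Vec n)} {π L : M → ℝ} {β : ℝ}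

lemma epsilonN_nonneg (n : ℕ) : 0 ≤ epsilonN n := by
  have := Real.log_natCast_nonneg n
  unfold epsilonN
  positivity

lemma sigmaBarSq_pos (hSstar : 0 ≤ residualDim Sstar) (μ : Vec n) {σ : ℝ} (hσ : σ ≠ 0) :
    0 < sigmaBarSq Sstar μ σ :=
  add_pos_of_pos_of_nonneg (by positivity) (div_nonneg (sq_nonneg _) hSstar)

lemma gibbsBound_eq_freeEnergy (μ : Vec n) (σ : ℝ) :
    gibbsBound S Sstar π L β μ σ = (1 + epsilonN n) * (sigmaBarSq Sstar μ σ / β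
        * freeEnergy π (fun m => β * (‖μ - (S m).starProjection μ‖ ^ 2
          - Module.finrank ℝ (S m) * σ ^ 2) / sigmaBarSq Sstar μ σ + L m))
      + σ ^ 2 / (2 * Real.log n) := by
  have exponent_eq (x t l : ℝ) : -(β * x / t + l) = -β * x / t - l := by ring
  simp only [gibbsBound, freeEnergy, partitionFunction, exponent_eq]
  ring

-- On `Sstar` all energies are shifted by `β * (d * σ ^ 2 - ‖ν‖ ^ 2) / t` with `d = dim Sstar`, a
-- shift which cancels against the other terms up to the factor `epsilonN n`.
lemma freeEnergy_meanResidualSq_le_gibbsBound (hn : 1 < n) (hS : ∀ m, S m ≤ Sstar)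
    (hπ : π ∈ stdSimplex ℝ M) (hβ : 0 < β) (θ : Sstar) (ν : Sstarᗮ) {σ : ℝ} (hσ : σ ≠ 0) :
    (1 + epsilonN n) * ((σ ^ 2 + ‖ν‖ ^ 2 / Module.finrank ℝ Sstarᗮ) / β
        * freeEnergy π (fun m => β * meanResidualSq ((S m).comap Sstar.subtype) θ σ
            / (σ ^ 2 + ‖ν‖ ^ 2 / Module.finrank ℝ Sstarᗮ) + L m))
      - Module.finrank ℝ Sstar * σ ^ 2 + ‖ν‖ ^ 2
      ≤ gibbsBound S Sstar π L β ((θ : Vec n) + ν) σ := by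
  rw [gibbsBound_eq_freeEnergy, sigmaBarSq_coe_add_coe_orthogonal]
  set t := σ ^ 2 + ‖ν‖ ^ 2 / Module.finrank ℝ Sstarᗮ
  set c := Module.finrank ℝ Sstar * σ ^ 2 - ‖ν‖ ^ 2 with hc
  set q : M → ℝ := fun m => β * (‖((θ : Vec n) + ν) - (S m).starProjection ((θ : Vec n) + ν)‖ ^ 2
    - Module.finrank ℝ (S m) * σ ^ 2) / t + L m
  have t_pos : 0 < t := by positivity
  have energy_shift (m : M) :
      β * meanResidualSq ((S m).comap Sstar.subtype) θ σ / t + L m = q m + β * c / t := by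
    rw [meanResidualSq_comap_subtype (hS m) θ ν]
    ring
  have finrank_le : (Module.finrank ℝ Sstar : ℝ) ≤ n := by
    exact_mod_cast Sstar.finrank_le.trans_eq finrank_euclideanSpace_fin
  have shift_le : epsilonN n * c ≤ σ ^ 2 / (2 * Real.log n) :=
    calc epsilonN n * c ≤ epsilonN n * (n * σ ^ 2) := by
          refine mul_le_mul_of_nonneg_left ?_ (epsilonN_nonneg n)
          linarith [mul_le_mul_of_nonneg_right finrank_le (sq_nonneg σ), sq_nonneg ‖ν‖]
      _ = σ ^ 2 / (2 * Real.log n) := by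
          have := Real.log_pos (show (1 : ℝ) < n by exact_mod_cast hn)
          rw [epsilonN]
          field_simp
  calc (1 + epsilonN n) * (t / β * freeEnergy π (fun m =>
          β * meanResidualSq ((S m).comap Sstar.subtype) θ σ / t + L m))
        - Module.finrank ℝ Sstar * σ ^ 2 + ‖ν‖ ^ 2
      = (1 + epsilonN n) * (t / β * freeEnergy π q) + epsilonN n * c := by
        simp_rw [energy_shift]
        rw [freeEnergy_add_const hπ]
        field_simp
        rw [hc]
        ring
    _ ≤ (1 + epsilonN n) * (t / β * freeEnergy π q) + σ ^ 2 / (2 * Real.log n) := by gcongr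

theorem integral_norm_sub_mixedEstimator_sq_le_gibbsBound (hn : 1 < n) (hS : ∀ m, S m ≤ Sstar)
    (hπ : π ∈ stdSimplex ℝ M) (hL : ∀ m, (Module.finrank ℝ (S m) : ℝ) / 2 ≤ L m)
    (hβ0 : 0 < β) (hβ : β < 1 / 4)
    (hN : Real.log n ≤ (residualDim Sstar - 2) * phi (4 * β)) (μ : Vec n) {σ : ℝ} (hσ : 0 < σ) :
    ∫ z, ‖μ - mixedEstimator S Sstar π L β (μ + σ • z)‖ ^ 2 ∂(stdGaussian (Vec n))
      ≤ gibbsBound S Sstar π L β μ σ := by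
  rw [residualDim_eq_finrank_orthogonal] at hN
  obtain ⟨θ, hθ, ν, hν, rfl⟩ := Sstar.exists_add_mem_mem_orthogonal μ
  lift θ to Sstar using hθ
  lift ν to Sstarᗮ using hν
  have risk_le := integral_integral_norm_sub_gibbsMixture_sq_le
    (T := fun m => (S m).comap Sstar.subtype) hn θ ν hσ hπ
    (fun m => by simpa only [(Submodule.comapSubtypeEquivOfLe (hS m)).finrank_eq] using hL m)
    hβ0 hβ hN (integrable_prod_norm_sub_gibbsMixture_sq hπ hS θ ν σ).integral_prod_right
  rw [integral_norm_sub_mixedEstimator_sq_eq hπ hS]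
  exact (add_le_add_left risk_le _).trans
    (freeEnergy_meanResidualSq_le_gibbsBound hn hS hπ hβ0 θ ν hσ.ne')

theorem gibbsBound_le_oracleBound (hπ : π ∈ stdSimplex ℝ M) (hβ : 0 < β)
    (hSstar : 0 ≤ residualDim Sstar) (μ : Vec n) {σ : ℝ} (hσ : σ ≠ 0) :
    gibbsBound S Sstar π L β μ σ ≤ oracleBound S Sstar π L β μ σ := by
  have t_pos := sigmaBarSq_pos hSstar μ hσ
  obtain ⟨m₀, hm₀⟩ := exists_pos_of_mem_stdSimplex hπ
  have : Nonempty {m : M // 0 < π m} := ⟨⟨m₀, hm₀⟩⟩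
  rw [gibbsBound_eq_freeEnergy, oracleBound]
  set t := sigmaBarSq Sstar μ σ
  have ε_nonneg := epsilonN_nonneg n
  gcongr
  refine le_ciInf fun ⟨m, hm⟩ => ?_
  calc t / β * freeEnergy π _
      ≤ t / β * (β * (‖μ - (S m).starProjection μ‖ ^ 2 - Module.finrank ℝ (S m) * σ ^ 2) / t + L m
        - Real.log (π m)) := by
        gcongr
        exact freeEnergy_le_sub_log hπ _ hm
    _ = ‖μ - (S m).starProjection μ‖ ^ 2 + t / β * (L m - Real.log (π m))
        - Module.finrank ℝ (S m) * σ ^ 2 := by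
        field_simp
        ring
    _ ≤ ‖μ - (S m).starProjection μ‖ ^ 2 + t / β * (L m - Real.log (π m)) :=
        sub_le_self _ (by positivity)

end RiskBounds

section Noise

lemma observation_eq_add_smul {n : ℕ} (μ : Vec n) (σ : ℝ) (e : Fin n → ℝ) :
    observation μ σ e = μ + σ • WithLp.toLp 2 e := by
  ext i
  simp [observation]

lemma hasLaw_toLp_stdGaussian {Ω ι : Type*} [MeasurableSpace Ω] {P : Measure Ω} [Fintype ι]
    {ε : ι → Ω → ℝ} (hε_indep : iIndepFun ε P) (hε_law : ∀ i, HasLaw (ε i) (gaussianReal 0 1) P) :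
    HasLaw (fun ω => WithLp.toLp 2 (fun i => ε i ω)) (stdGaussian (EuclideanSpace ℝ ι)) P := by
  have toLp_law : HasLaw (WithLp.toLp 2) (stdGaussian (EuclideanSpace ℝ ι))
      (Measure.pi fun _ : ι => gaussianReal 0 1) := ⟨by fun_prop, map_pi_eq_stdGaussian⟩
  exact toLp_law.comp (hε_indep.hasLaw_pi hε_law)

end Noise

end GibbsMixing

theorem theorem1 {Ω : Type*} [MeasurableSpace Ω] (P : Measure Ω) [IsProbabilityMeasure P]
    (n : ℕ) (hn : 3 ≤ n)
    (μ : GibbsMixing.Vec n) (σ : ℝ) (hσ : 0 < σ)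
    (ε : Fin n → Ω → ℝ)
    (hε_indep : iIndepFun ε P)
    (hε_law : ∀ i, HasLaw (ε i) (gaussianReal 0 1) P)
    {M : Type*} [Fintype M]
    (S : M → Submodule ℝ (GibbsMixing.Vec n)) (Sstar : Submodule ℝ (GibbsMixing.Vec n))
    (hS : ∀ m, S m ≤ Sstar)
    (π : M → ℝ) (hπ_nonneg : ∀ m, 0 ≤ π m) (hπ_sum : ∑ m, π m = 1)
    (L : M → ℝ) (hL : ∀ m, (Module.finrank ℝ (S m) : ℝ) / 2 ≤ L m)
    (β : ℝ) (hβ_pos : 0 < β) (hβ : β < 1 / 4)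
    (hN : 2 + Real.log n / GibbsMixing.phi (4 * β) ≤ GibbsMixing.residualDim Sstar) :
    Integrable (fun ω => ‖μ - GibbsMixing.mixedEstimator S Sstar π L β
        (GibbsMixing.observation μ σ (fun i => ε i ω))‖ ^ 2) P ∧
    ∫ ω, ‖μ - GibbsMixing.mixedEstimator S Sstar π L β
        (GibbsMixing.observation μ σ (fun i => ε i ω))‖ ^ 2 ∂P
      ≤ GibbsMixing.gibbsBound S Sstar π L β μ σ ∧
    GibbsMixing.gibbsBound S Sstar π L β μ σ ≤ GibbsMixing.oracleBound S Sstar π L β μ σ := by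
  have hπ : π ∈ stdSimplex ℝ M := ⟨hπ_nonneg, hπ_sum⟩
  have one_lt_n : 1 < n := by linarith
  have phi_pos := GibbsMixing.phi_pos (show 0 < 4 * β by linarith) (by linarith)
  have log_le : Real.log n ≤ (GibbsMixing.residualDim Sstar - 2) * GibbsMixing.phi (4 * β) :=
    (div_le_iff₀ phi_pos).1 (by linarith)
  have two_lt := GibbsMixing.two_lt_of_log_le_sub_two_mul_phi (by linarith) (by linarith)
    one_lt_n log_le
  have noise_law := GibbsMixing.hasLaw_toLp_stdGaussian hε_indep hε_law
  have loss_int := GibbsMixing.integrable_norm_sub_mixedEstimator_sq (S := S) (Sstar := Sstar)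
    (L := L) (β := β) hπ μ σ
  have risk_le := GibbsMixing.integral_norm_sub_mixedEstimator_sq_le_gibbsBound one_lt_n hS hπ hL
    hβ_pos hβ log_le μ hσ
  simp_rw [GibbsMixing.observation_eq_add_smul]
  refine ⟨?_, ?_, GibbsMixing.gibbsBound_le_oracleBound hπ hβ_pos (by linarith) μ hσ.ne'⟩
  · rw [← noise_law.map_eq] at loss_int
    exact loss_int.comp_aemeasurable noise_law.aemeasurable
  · rwa [← noise_law.integral_comp loss_int.1] at risk_le
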